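/- Let $\Gamma$ be a subgroup of finite index in the modular group $SL_2(\mathbb{Z})$ and let $k$ be any real number. Powers are defined by $w^{s}=|w|^{s}e^{is\arg w}$ with $-\pi\le \arg w<\pi$. Let $v:\Gamma\to\mathbb{C}\setminus\{0\}$ be a multiplier system for the weight $-k$, that is, $$v(M_1M_2)(c_3z+d_3)^{-k}=v(M_1)v(M_2)(c_1M_2z+d_1)^{-k}(c_2z+d_2)^{-k}$$ for all $M_1,M_2\in\Gamma$, $M_3=M_1M_2$ and $z$ in the upper half-plane $\mathbb{H}$, where $(c_i,d_i)$ is the lower row of $M_i$. Assume that $v$ is weakly parabolic: $|v(P)|=1$ for every parabolic $P\in\Gamma$ (it is not assumed that $|v(M)|=1$ for all $M\in\Gamma$). For $F:\mathbb{H}\to\mathbb{C}$ and $M=\begin{pmatrix}a&b\\c&d\end{pmatrix}\in\Gamma$ put $(F|_v^{-k}M)(z)=F(Mz)\,v(M)^{-1}(cz+d)^{k}$. Let $\mathbb{P}$ be the space of all holomorphic $g:\mathbb{H}\to\mathbb{C}$ with $|g(z)|<K(|z|^{\rho}+y^{-\sigma})$, $y=\operatorname{Im}z$, for some positive constants $K,\rho,\sigma$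 depending on $g$. A cocycle in $\mathbb{P}$ is a family $\{\varphi_M\}_{M\in\Gamma}$ in $\mathbb{P}$ with $\varphi_{M_1M_2}=\varphi_{M_1}|_v^{-k}M_2+\varphi_{M_2}$ for all $M_1,M_2\in\Gamma$. A coboundary is a family in $\mathbb{P}$ of the form $\varphi_M=\varphi|_v^{-k}M-\varphi$, $M\in\Gamma$, with a fixed $\varphi\in\mathbb{P}$. A cocycle is parabolic if for every parabolic cusp $q$ of $\Gamma$ and every parabolic $Q\in\Gamma$ fixing $q$ that generates the stabilizer $\Gamma_q$ up to sign (every element of $\Gamma_q$ lies in $\langle Q,-I\rangle$) there is $\varphi_q\in\mathbb{P}$ with $\varphi_Q=\varphi_q|_v^{-k}Q-\varphi_q$. Let $H_{-k,v}(\Gamma,\mathbb{P})$ be the quotient of the space of cocycles by the space of coboundaries, and let $\tilde H_{-k,v}(\Gamma,\mathbb{P})$ be its subspace of classes of parabolic cocycles. Then every cocycle in $\mathbb{P}$ is parabolic, and hence $H_{-k,v}(\Gamma,\mathbb{P})=\tilde H_{-k,v}(\Gamma,\mathbb{P})$. -/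

import Mathlib

open UpperHalfPlane
open scoped MatrixGroups

noncomputable section

namespace EichlerCohomology

/-- The argument of a complex number normalised to `[-π, π)` (Mathlib's `Complex.arg` takes
values in `(-π, π]`). -/
def argL (w : ℂ) : ℝ := if Complex.arg w = Real.pi then -Real.pi else Complex.arg w

/-- The real power `w ^ k = |w| ^ k * exp (i k arg w)`, with `-π ≤ arg w < π`, for `w ≠ 0`. -/
def rpowL (w : ℂ) (k : ℝ) : ℂ :=
  ((‖w‖ ^ k : ℝ) : ℂ) * Complex.exp (Complex.I * ((k * argL w : ℝ) : ℂ))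

/-- The factor of automorphy `c z + d` of `M = (a b; c d)`. -/
def autFactor (M : SL(2, ℤ)) (z : ℍ) : ℂ := ((M 1 0 : ℤ) : ℂ) * (z : ℂ) + ((M 1 1 : ℤ) : ℂ)

/-- `v` is a (not necessarily unitary) multiplier system on `Γ` in weight `r`: it has no zeros and
`v(M₁M₂) (c₃ z + d₃)^r = v(M₁) v(M₂) (c₁ M₂z + d₁)^r (c₂ z + d₂)^r`, where `M₃ = M₁M₂`. -/
structure IsMultiplierSystem (Γ : Subgroup SL(2, ℤ)) (r : ℝ) (v : Γ → ℂ) : Prop where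
  ne_zero : ∀ M : Γ, v M ≠ 0
  consistency : ∀ (M₁ M₂ : Γ) (z : ℍ),
    v (M₁ * M₂) * rpowL (autFactor ((M₁ * M₂ : Γ) : SL(2, ℤ)) z) r =
      v M₁ * v M₂ * rpowL (autFactor (M₁ : SL(2, ℤ)) ((M₂ : SL(2, ℤ)) • z)) r *
        rpowL (autFactor (M₂ : SL(2, ℤ)) z) r

/-- An integral matrix of determinant one is parabolic if it is parabolic as a real matrix:
not scalar, and with a single eigenvalue. -/
def IsParabolicElt (M : SL(2, ℤ)) : Prop :=
  (Matrix.SpecialLinearGroup.mapGL ℝ M).IsParabolic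

/-- `v` is weakly parabolic: `|v(P)| = 1` for all parabolic `P ∈ Γ`. -/
def IsWeaklyParabolic (Γ : Subgroup SL(2, ℤ)) (v : Γ → ℂ) : Prop :=
  ∀ P : Γ, IsParabolicElt (P : SL(2, ℤ)) → ‖v P‖ = 1

/-- The stroke operator in weight `r`: `(F ∣ M)(z) = F(Mz) v(M)⁻¹ (cz+d)^(-r)`. -/
def stroke {Γ : Subgroup SL(2, ℤ)} (r : ℝ) (v : Γ → ℂ) (F : ℍ → ℂ) (M : Γ) : ℍ → ℂ :=
  fun z => F ((M : SL(2, ℤ)) • z) * (v M)⁻¹ * rpowL (autFactor (M : SL(2, ℤ)) z) (-r)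

section helpers

variable {Γ : Subgroup SL(2, ℤ)} {r : ℝ} {v : Γ → ℂ}

theorem stroke_zero (M : Γ) : stroke r v 0 M = 0 := by
  ext z; simp [stroke]

theorem stroke_add (F G : ℍ → ℂ) (M : Γ) :
    stroke r v (F + G) M = stroke r v F M + stroke r v G M := by
  ext z; simp [stroke]; ring

theorem stroke_sub (F G : ℍ → ℂ) (M : Γ) :
    stroke r v (F - G) M = stroke r v F M - stroke r v G M := by
  ext z; simp [stroke]; ring

theorem stroke_smul (a : ℂ) (F : ℍ → ℂ) (M : Γ) :
    stroke r v (a • F) M = a • stroke r v F M := by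
  ext z; simp [stroke]; ring

theorem rpowL_neg (w : ℂ) (k : ℝ) : rpowL w (-k) = (rpowL w k)⁻¹ := by
  have h : 0 ≤ ‖w‖ := norm_nonneg w
  simp only [rpowL, mul_inv, Real.rpow_neg h, ← Complex.exp_neg]
  push_cast
  congr 2
  ring

/-- For a multiplier system in weight `r` the stroke operator is a right action. -/
theorem stroke_mul (hv : IsMultiplierSystem Γ r v) (F : ℍ → ℂ) (M₁ M₂ : Γ) :
    stroke r v F (M₁ * M₂) = stroke r v (stroke r v F M₁) M₂ := by
  ext z
  have h := congrArg (fun x => x⁻¹) (hv.consistency M₁ M₂ z)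
  simp only [mul_inv] at h
  simp only [stroke, rpowL_neg]
  rw [mul_assoc, h, Subgroup.coe_mul, mul_smul]
  ring

end helpers

/-- The bound `|g(z)| < K (|z|^ρ + y^(-σ))`, `y = Im z`, for some positive `K, ρ, σ`. -/
def HasGrowth (g : ℍ → ℂ) : Prop :=
  ∃ K ρ σ : ℝ, 0 < K ∧ 0 < ρ ∧ 0 < σ ∧
    ∀ z : ℍ, ‖g z‖ < K * (‖(z : ℂ)‖ ^ ρ + z.im ^ (-σ))

theorem growth_aux (z : ℍ) {ρ σ ρ' σ' : ℝ} (hρ : 0 < ρ) (hσ : 0 < σ) (h1 : ρ ≤ ρ') (h2 : σ ≤ σ') :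
    ‖(z : ℂ)‖ ^ ρ + z.im ^ (-σ) ≤ 3 * (‖(z : ℂ)‖ ^ ρ' + z.im ^ (-σ')) := by
  have hy : 0 < z.im := z.im_pos
  have hyz : z.im ≤ ‖(z : ℂ)‖ := by
    have := Complex.abs_im_le_norm (z : ℂ)
    rw [UpperHalfPlane.coe_im] at this
    exact (le_abs_self _).trans this
  have hz : 0 < ‖(z : ℂ)‖ := hy.trans_le hyz
  have pa := Real.rpow_pos_of_pos hz ρ'
  have pb := Real.rpow_pos_of_pos hy (-σ')
  have one_le : 1 ≤ ‖(z : ℂ)‖ ^ ρ' + z.im ^ (-σ') := by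
    rcases le_total 1 ‖(z : ℂ)‖ with h | h
    · have := Real.one_le_rpow h (hρ.le.trans h1)
      linarith
    · have := Real.one_le_rpow_of_pos_of_le_one_of_nonpos hy (hyz.trans h)
        (neg_nonpos.2 (hσ.le.trans h2))
      linarith
  have ha : ‖(z : ℂ)‖ ^ ρ ≤ 1 + ‖(z : ℂ)‖ ^ ρ' := by
    rcases le_total 1 ‖(z : ℂ)‖ with h | h
    · have := Real.rpow_le_rpow_of_exponent_le h h1
      linarith
    · have := Real.rpow_le_one hz.le h hρ.le
      linarith
  have hb : z.im ^ (-σ) ≤ 1 + z.im ^ (-σ') := by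
    rcases le_total 1 z.im with h | h
    · have := Real.rpow_le_one_of_one_le_of_nonpos h (neg_nonpos.2 hσ.le)
      linarith
    · have := Real.rpow_le_rpow_of_exponent_ge hy h (neg_le_neg h2)
      linarith
  linarith

theorem HasGrowth.zero : HasGrowth 0 := by
  refine ⟨1, 1, 1, one_pos, one_pos, one_pos, fun z => ?_⟩
  have hz : 0 < ‖(z : ℂ)‖ := norm_pos_iff.2 z.ne_zero
  have := Real.rpow_pos_of_pos hz 1
  have := Real.rpow_pos_of_pos z.im_pos (-1)
  simp only [Pi.zero_apply, norm_zero]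
  positivity

theorem HasGrowth.add {f g : ℍ → ℂ} (hf : HasGrowth f) (hg : HasGrowth g) :
    HasGrowth (f + g) := by
  obtain ⟨K, ρ, σ, hK, hρ, hσ, h⟩ := hf
  obtain ⟨K', ρ', σ', hK', hρ', hσ', h'⟩ := hg
  refine ⟨3 * (K + K'), max ρ ρ', max σ σ', by positivity, lt_max_of_lt_left hρ,
    lt_max_of_lt_left hσ, fun z => ?_⟩
  have a := mul_le_mul_of_nonneg_left
    (growth_aux z hρ hσ (le_max_left ρ ρ') (le_max_left σ σ')) hK.le
  have b := mul_le_mul_of_nonneg_left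
    (growth_aux z hρ' hσ' (le_max_right ρ ρ') (le_max_right σ σ')) hK'.le
  have c := norm_add_le (f z) (g z)
  have := h z
  have := h' z
  rw [Pi.add_apply]
  linarith

theorem HasGrowth.smul (a : ℂ) {g : ℍ → ℂ} (hg : HasGrowth g) : HasGrowth (a • g) := by
  obtain ⟨K, ρ, σ, hK, hρ, hσ, h⟩ := hg
  refine ⟨(‖a‖ + 1) * K, ρ, σ, by positivity, hρ, hσ, fun z => ?_⟩
  rw [Pi.smul_apply, norm_smul, mul_assoc]
  have h0 := norm_nonneg a
  have h1 := norm_nonneg (g z)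
  have h2 := mul_le_mul_of_nonneg_left (h z).le h0
  have := h z
  linarith

/-- The space `ℙ` of holomorphic functions on the upper half-plane with the growth condition. -/
def spaceP : Submodule ℂ (ℍ → ℂ) where
  carrier := {g | MDifferentiable (modelWithCornersSelf ℂ ℂ) (modelWithCornersSelf ℂ ℂ) g ∧
    HasGrowth g}
  zero_mem' := ⟨mdifferentiable_const, HasGrowth.zero⟩
  add_mem' := fun hf hg => ⟨hf.1.add hg.1, hf.2.add hg.2⟩
  smul_mem' := fun a _ hg => ⟨hg.1.const_smul a, hg.2.smul a⟩

/-- The cocycles in `ℙ` with respect to the stroke operator in weight `r`: the families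
`{φ_M : M ∈ Γ}` in `ℙ` with `φ_{M₁M₂} = φ_{M₁} ∣ M₂ + φ_{M₂}`. -/
def cocycles (Γ : Subgroup SL(2, ℤ)) (r : ℝ) (v : Γ → ℂ) : Submodule ℂ (Γ → ℍ → ℂ) where
  carrier := {φ | (∀ M, φ M ∈ spaceP) ∧
    ∀ M₁ M₂ : Γ, φ (M₁ * M₂) = stroke r v (φ M₁) M₂ + φ M₂}
  zero_mem' := ⟨fun _ => spaceP.zero_mem, fun _ _ => by simp [stroke_zero]⟩
  add_mem' := fun {φ ψ} hφ hψ => ⟨fun M => spaceP.add_mem (hφ.1 M) (hψ.1 M), fun M₁ M₂ => by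
    simp only [Pi.add_apply, stroke_add, hφ.2 M₁ M₂, hψ.2 M₁ M₂]; abel⟩
  smul_mem' := fun a φ hφ => ⟨fun M => spaceP.smul_mem a (hφ.1 M), fun M₁ M₂ => by
    simp only [Pi.smul_apply, stroke_smul, hφ.2 M₁ M₂, smul_add]⟩

/-- The coboundaries: the families `{φ_M : M ∈ Γ}` in `ℙ` of the form `φ_M = ρ ∣ M - ρ` with a
fixed `ρ ∈ ℙ`. -/
def coboundaries (Γ : Subgroup SL(2, ℤ)) (r : ℝ) (v : Γ → ℂ) : Submodule ℂ (Γ → ℍ → ℂ) where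
  carrier := {φ | (∀ M, φ M ∈ spaceP) ∧ ∃ ρ ∈ spaceP, ∀ M : Γ, φ M = stroke r v ρ M - ρ}
  zero_mem' := ⟨fun _ => spaceP.zero_mem, 0, spaceP.zero_mem, fun _ => by simp [stroke_zero]⟩
  add_mem' := by
    rintro φ ψ ⟨hφ, ρ, hρ, h⟩ ⟨hψ, τ, hτ, h'⟩
    refine ⟨fun M => spaceP.add_mem (hφ M) (hψ M), ρ + τ, spaceP.add_mem hρ hτ, fun M => ?_⟩
    rw [Pi.add_apply, h, h', stroke_add]; abel
  smul_mem' := by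
    rintro a φ ⟨hφ, ρ, hρ, h⟩
    refine ⟨fun M => spaceP.smul_mem a (hφ M), a • ρ, spaceP.smul_mem a hρ, fun M => ?_⟩
    rw [Pi.smul_apply, h, stroke_smul, smul_sub]

/-- `q` is a parabolic cusp of `Γ` and `Q ∈ Γ` is a parabolic element fixing `q` which, up to sign,
generates the stabilizer of `q` in `Γ`. -/
structure IsCuspGenerator (Γ : Subgroup SL(2, ℤ)) (q : OnePoint ℝ) (Q : Γ) : Prop where
  parabolic : IsParabolicElt (Q : SL(2, ℤ))
  fixes : Matrix.SpecialLinearGroup.mapGL ℝ (Q : SL(2, ℤ)) • q = q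
  generates : ∀ M : Γ, Matrix.SpecialLinearGroup.mapGL ℝ (M : SL(2, ℤ)) • q = q →
    (M : SL(2, ℤ)) ∈ Subgroup.closure {(Q : SL(2, ℤ)), -1}

/-- The parabolic cocycles: at every cusp `q` of `Γ`, with generator `Q` of its stabilizer, there is
`ρ ∈ ℙ` (depending on the cusp) with `φ_Q = ρ ∣ Q - ρ`. By the cocycle relation the condition at a
cusp is equivalent to that at any `Γ`-equivalent cusp, so that imposing it at all cusps is the same
as imposing it at a complete set of inequivalent ones. -/
def parabolicCocycles (Γ : Subgroup SL(2, ℤ)) (r : ℝ) (v : Γ → ℂ) :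
    Submodule ℂ (Γ → ℍ → ℂ) where
  carrier := {φ | φ ∈ cocycles Γ r v ∧ ∀ (q : OnePoint ℝ) (Q : Γ), IsCuspGenerator Γ q Q →
    ∃ ρ ∈ spaceP, φ Q = stroke r v ρ Q - ρ}
  zero_mem' := ⟨(cocycles Γ r v).zero_mem, fun _ _ _ =>
    ⟨0, spaceP.zero_mem, by simp [stroke_zero]⟩⟩
  add_mem' := by
    rintro φ ψ ⟨hφ, h⟩ ⟨hψ, h'⟩
    refine ⟨(cocycles Γ r v).add_mem hφ hψ, fun q Q hQ => ?_⟩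
    obtain ⟨ρ, hρ, e⟩ := h q Q hQ
    obtain ⟨τ, hτ, e'⟩ := h' q Q hQ
    refine ⟨ρ + τ, spaceP.add_mem hρ hτ, ?_⟩
    rw [Pi.add_apply, e, e', stroke_add]; abel
  smul_mem' := by
    rintro a φ ⟨hφ, h⟩
    refine ⟨(cocycles Γ r v).smul_mem a hφ, fun q Q hQ => ?_⟩
    obtain ⟨ρ, hρ, e⟩ := h q Q hQ
    refine ⟨a • ρ, spaceP.smul_mem a hρ, ?_⟩
    rw [Pi.smul_apply, e, stroke_smul, smul_sub]

/-- Every coboundary is a parabolic cocycle. -/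
theorem coboundaries_le_parabolicCocycles {Γ : Subgroup SL(2, ℤ)} {r : ℝ} {v : Γ → ℂ}
    (hv : IsMultiplierSystem Γ r v) : coboundaries Γ r v ≤ parabolicCocycles Γ r v := by
  rintro φ ⟨hφ, ρ, hρ, h⟩
  refine ⟨⟨hφ, fun M₁ M₂ => ?_⟩, fun _ Q _ => ⟨ρ, hρ, h Q⟩⟩
  rw [h, h, h, stroke_mul hv, stroke_sub]; abel

/-- The Eichler cohomology group in weight `r`: cocycles modulo coboundaries. -/
abbrev Cohomology (Γ : Subgroup SL(2, ℤ)) (r : ℝ) (v : Γ → ℂ) : Type :=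
  cocycles Γ r v ⧸ (coboundaries Γ r v).submoduleOf (cocycles Γ r v)

/-- The parabolic Eichler cohomology group in weight `r`: the subspace of the Eichler cohomology
group of the classes of parabolic cocycles. -/
def parabolicCohomology (Γ : Subgroup SL(2, ℤ)) (r : ℝ) (v : Γ → ℂ) :
    Submodule ℂ (Cohomology Γ r v) :=
  ((parabolicCocycles Γ r v).submoduleOf (cocycles Γ r v)).map
    ((coboundaries Γ r v).submoduleOf (cocycles Γ r v)).mkQ

end EichlerCohomology

end

/-! For parabolic `Q` with `|v(Q)| = 1`, the equation `ρ ∣ Q - ρ = g` is solvable in `ℙ` for every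
`g` in `ℙ`, so each `φ_Q` has a primitive at its cusp. Moving the fixed point of `Q` to infinity and
rescaling turns this into `f(z + 1) - ε f(z) = g(z)` with `|ε| = 1`
(`exists_moderate_solution_parabolic`). Membership in `ℙ` amounts to a bound by a power of `(1 +
|z|²) / y`, which is stable under these substitutions.

The formal solutions `Σ εⁿ g(z - 1 - n)` and `-Σ ε^(-n-1) g(z + n)` diverge in general. A
holomorphic partition of unity `W + V = 1`, with `W` decaying to the left and `V` to the right
faster than `g` can grow (`exists_cutoff`), makes the first converge for `gW` and the second for
`gV`; their sum solves the equation. It is built from `Σ_n (sin π(z - n) / π(z - n))² = 1` by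
splitting the sum at `n = 0`.

The price is a factor `exp(c y)`. Using `W(δz)` and `V(δz)` lowers it to `exp(c δ y)`, at the cost
of a power of `1/δ` (`exists_solution_exp_growth`). With `δ₀` fixed and small, compare its solution
`f` at height `y ≥ 1` with the solution `f'` for `δ = δ₀ / y`, which is polynomially bounded at that
height. The difference satisfies `p(z + 1) = ε p(z)` and grows too slowly to have a pole in `q =
exp(2πiz)`, so the maximum principle bounds it by its values on `y = 1`
(`norm_le_of_quasiperiodic`), which are polynomial in `1/δ`, that is, in `y`. Hence `f` itself has
moderate growth (`exists_moderate_solution`). -/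

noncomputable section

namespace EichlerCohomology

/-! ### Bounds for the squared cardinal sine -/

/-- The square of the normalised cardinal sine `sin (π u) / (π u)`. -/
def sincSq (u : ℂ) : ℂ := (Complex.sin (Real.pi * u) / (Real.pi * u)) ^ 2

theorem norm_sin_le_exp (w : ℂ) : ‖Complex.sin w‖ ≤ Real.exp |w.im| := by
  have h1 : ‖Complex.exp (-w * Complex.I)‖ ≤ Real.exp |w.im| := by
    rw [Complex.norm_exp]; simpa using le_abs_self w.im
  have h2 : ‖Complex.exp (w * Complex.I)‖ ≤ Real.exp |w.im| := by
    rw [Complex.norm_exp]; simpa using neg_le_abs w.im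
  have h3 := norm_sub_le (Complex.exp (-w * Complex.I)) (Complex.exp (w * Complex.I))
  rw [Complex.sin, norm_div, norm_mul, Complex.norm_I, Complex.norm_two]
  linarith

theorem norm_cos_le_exp (w : ℂ) : ‖Complex.cos w‖ ≤ Real.exp |w.im| := by
  have h1 : ‖Complex.exp (-w * Complex.I)‖ ≤ Real.exp |w.im| := by
    rw [Complex.norm_exp]; simpa using le_abs_self w.im
  have h2 : ‖Complex.exp (w * Complex.I)‖ ≤ Real.exp |w.im| := by
    rw [Complex.norm_exp]; simpa using neg_le_abs w.im
  have h3 := norm_add_le (Complex.exp (w * Complex.I)) (Complex.exp (-w * Complex.I))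
  rw [Complex.cos, norm_div, Complex.norm_two]
  linarith

/-- Mean value inequality on the convex strip `|Im u| ≤ |Im w|`, where the derivative `cos` is at
most `exp |Im w|`. This controls the cardinal sine near `0`. -/
theorem norm_sin_le_mul_exp (w : ℂ) : ‖Complex.sin w‖ ≤ ‖w‖ * Real.exp |w.im| := by
  have hs : Convex ℝ {u : ℂ | |u.im| ≤ |w.im|} := by
    have : {u : ℂ | |u.im| ≤ |w.im|} = Complex.imLm ⁻¹' (Set.Icc (-|w.im|) |w.im|) := by
      ext u; simp [abs_le]
    rw [this]
    exact (convex_Icc _ _).linear_preimage _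
  have := hs.norm_image_sub_le_of_norm_deriv_le (𝕜 := ℂ) (f := Complex.sin) (x := 0) (y := w)
    (C := Real.exp |w.im|) (fun u _ => Complex.differentiable_sin u)
    (fun u hu => by
      rw [Complex.deriv_sin]
      exact (norm_cos_le_exp u).trans (Real.exp_le_exp.2 hu)) (by simp) (by simp)
  simpa [mul_comm] using this

theorem norm_sincSq_le {u : ℂ} (hu : 0 < u.im) :
    ‖sincSq u‖ ≤ 4 * Real.exp (2 * Real.pi * u.im) / (1 + ‖u‖) ^ 2 := by
  have hpi := Real.pi_gt_three
  have hu0 : u ≠ 0 := by rintro rfl; simp at hu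
  have hn : 0 < ‖u‖ := norm_pos_iff.2 hu0
  have him : |((Real.pi : ℂ) * u).im| = Real.pi * u.im := by
    simp [abs_of_pos, hu, Real.pi_pos]
  have a := norm_sin_le_exp (Real.pi * u)
  have b := norm_sin_le_mul_exp (Real.pi * u)
  rw [him] at a b
  have hnp : ‖(Real.pi : ℂ) * u‖ = Real.pi * ‖u‖ := by simp [abs_of_pos Real.pi_pos]
  rw [hnp] at b
  have key : ‖Complex.sin (Real.pi * u) / (Real.pi * u)‖ ≤
      2 * Real.exp (Real.pi * u.im) / (1 + ‖u‖) := by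
    rw [norm_div, hnp, div_le_div_iff₀ (by positivity) (by positivity)]
    have he := Real.exp_pos (Real.pi * u.im)
    have := mul_le_mul_of_nonneg_right a hn.le
    have h3 : 0 ≤ (Real.pi - 1) * (‖u‖ * Real.exp (Real.pi * u.im)) := by
      apply mul_nonneg <;> [linarith; positivity]
    nlinarith
  calc ‖sincSq u‖ = ‖Complex.sin (Real.pi * u) / (Real.pi * u)‖ ^ 2 := by rw [sincSq, norm_pow]
    _ ≤ (2 * Real.exp (Real.pi * u.im) / (1 + ‖u‖)) ^ 2 := by gcongr
    _ = _ := by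
      rw [div_pow, mul_pow, ← Real.exp_nat_mul]; norm_num; ring_nf

theorem differentiableAt_sincSq {u : ℂ} (hu : 0 < u.im) : DifferentiableAt ℂ sincSq u := by
  have hu0 : u ≠ 0 := by rintro rfl; simp at hu
  unfold sincSq
  refine DifferentiableAt.pow (DifferentiableAt.div (by fun_prop) (by fun_prop) ?_) 2
  simp [hu0, Real.pi_ne_zero]

/-! ### Half-sums of integer translates -/

theorem isOpen_im_pos : IsOpen {z : ℂ | 0 < z.im} :=
  isOpen_lt continuous_const Complex.continuous_im

theorem summable_one_div_nat_add_one_sq : Summable fun n : ℕ => 1 / ((1 : ℝ) + n) ^ 2 := by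
  have := (summable_nat_add_iff 1).2 (Real.summable_one_div_nat_pow.2 (one_lt_two))
  refine this.congr fun n => ?_
  push_cast; ring

/-- A series of holomorphic functions dominated by `Φ(z) a_n`, with `Φ` continuous and `Σ a_n`
convergent, is holomorphic and bounded by `Φ(z) Σ a_n`. -/
theorem tsum_of_dominated {U : Set ℂ} (hU : IsOpen U) {T : ℕ → ℂ → ℂ} {Φ : ℂ → ℝ} {a : ℕ → ℝ}
    (ha : Summable a) (ha0 : ∀ n, 0 ≤ a n) (hT : ∀ n, DifferentiableOn ℂ (T n) U)
    (hΦ : ContinuousOn Φ U)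
    (hb : ∀ n, ∀ z ∈ U, ‖T n z‖ ≤ Φ z * a n) :
    DifferentiableOn ℂ (fun z => ∑' n, T n z) U ∧
      (∀ z ∈ U, Summable fun n => T n z) ∧ ∀ z ∈ U, ‖∑' n, T n z‖ ≤ Φ z * ∑' n, a n := by
  refine ⟨fun z hz => ?_, fun z hz => (ha.mul_left (Φ z)).of_norm_bounded (hb · z hz),
    fun z hz => ?_⟩
  -- Near `z` the weight stays below `Φ z + 1`, which gives a uniform summable majorant on a
  -- neighbourhood.
  · have hV : IsOpen (U ∩ Φ ⁻¹' Set.Iio (Φ z + 1)) := hΦ.isOpen_inter_preimage hU isOpen_Iio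
    have hzV : z ∈ U ∩ Φ ⁻¹' Set.Iio (Φ z + 1) := ⟨hz, by simp⟩
    have := Complex.differentiableOn_tsum_of_summable_norm (ha.mul_left (Φ z + 1))
      (fun n => (hT n).mono Set.inter_subset_left) hV (fun n w hw => (hb n w hw.1).trans
        (mul_le_mul_of_nonneg_right (le_of_lt hw.2) (ha0 n)))
    exact (this.differentiableAt (hV.mem_nhds hzV)).differentiableWithinAt
  · rw [← tsum_mul_left]
    exact tsum_of_norm_bounded (ha.mul_left (Φ z)).hasSum (hb · z hz)

/-- A Peetre-type inequality: it trades decay in `u + x` for decay in `x`, at the price of a power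
of `1 + ‖u‖`. -/
theorem one_add_mul_le (u : ℂ) (x : ℝ) : 1 + |x| ≤ (1 + ‖u + x‖) * (1 + ‖u‖) := by
  have h : |x| ≤ ‖u + x‖ + ‖u‖ := by
    have := norm_sub_le (u + x) u
    simpa using this
  have := mul_nonneg (norm_nonneg (u + x)) (norm_nonneg u)
  linarith

theorem norm_sincSq_add_le {u : ℂ} (hu : 0 < u.im) (x : ℝ) :
    ‖sincSq (u + x)‖ ≤ 4 * Real.exp (2 * Real.pi * u.im) * (1 + ‖u‖) ^ 2 / (1 + |x|) ^ 2 := by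
  have h := norm_sincSq_le (u := u + x) (by simpa using hu)
  have him : (u + (x : ℂ)).im = u.im := by simp
  rw [him] at h
  refine h.trans ?_
  have h1 := one_add_mul_le u x
  have h0 : 0 ≤ |x| := abs_nonneg x
  have h2 : (1 + |x|) ^ 2 ≤ (1 + ‖u + x‖) ^ 2 * (1 + ‖u‖) ^ 2 := by
    rw [← mul_pow]; gcongr
  rw [div_le_div_iff₀ (by positivity) (by positivity)]
  have := mul_le_mul_of_nonneg_left h2 (by positivity : 0 ≤ 4 * Real.exp (2 * Real.pi * u.im))
  linarith

/-- The sum of `sincSq` over the translates by the integers `≥ 0`. -/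
def cutL (z : ℂ) : ℂ := ∑' n : ℕ, sincSq (z - n)

/-- The sum of `sincSq` over the translates by the integers `< 0`. -/
def cutR (z : ℂ) : ℂ := ∑' n : ℕ, sincSq (z + (n + 1))

/-- The growth of the cutoff functions in the vertical direction. -/
def cutBound (u : ℂ) : ℝ := Real.exp (2 * Real.pi * u.im) * (1 + ‖u‖) ^ 2

theorem continuous_cutBound : Continuous cutBound := by unfold cutBound; fun_prop

theorem one_le_cutBound {u : ℂ} (hu : 0 < u.im) : 1 ≤ cutBound u := by
  have h1 : 1 ≤ Real.exp (2 * Real.pi * u.im) := Real.one_le_exp (by have := Real.pi_pos; positivity)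
  have h2 : 1 ≤ (1 + ‖u‖) ^ 2 := one_le_pow₀ (by have := norm_nonneg u; linarith)
  exact one_le_mul_of_one_le_of_one_le h1 h2

/-- The exponent `2` is split as `1/2 + 3/2`: the part `3/2` makes the sum over `n` converge, the
part `1/2` remains as decay in `s`. -/
theorem one_div_sq_le (s : ℝ) (hs : 0 ≤ s) (n : ℕ) :
    1 / (1 + (s + n)) ^ 2 ≤ (1 + s) ^ (-(1 / 2) : ℝ) * (1 + (n : ℝ)) ^ (-(3 / 2) : ℝ) := by
  have hn : (0 : ℝ) ≤ n := n.cast_nonneg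
  have e : 1 / (1 + (s + n)) ^ 2 = (1 + (s + n)) ^ (-(1 / 2) : ℝ) * (1 + (s + n)) ^ (-(3 / 2) : ℝ) := by
    rw [← Real.rpow_add (by positivity), one_div, ← Real.rpow_natCast, ← Real.rpow_neg (by positivity)]
    norm_num
  rw [e]
  refine mul_le_mul ?_ ?_ (by positivity) (by positivity)
  · exact Real.rpow_le_rpow_of_nonpos (by positivity) (by linarith) (by norm_num)
  · exact Real.rpow_le_rpow_of_nonpos (by positivity) (by linarith) (by norm_num)

theorem summable_rpow_three_halves :
    Summable fun n : ℕ => (1 + (n : ℝ)) ^ (-(3 / 2) : ℝ) := by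
  have := (summable_nat_add_iff 1).2 (Real.summable_nat_rpow.2 (by norm_num : (-(3 / 2) : ℝ) < -1))
  refine this.congr fun n => ?_
  push_cast; rw [add_comm]

theorem differentiableOn_sincSq_add (x : ℝ) :
    DifferentiableOn ℂ (fun z => sincSq (z + x)) {z | 0 < z.im} := fun z hz => by
  have hz' : 0 < (z + (x : ℂ)).im := by simpa using hz
  exact (DifferentiableAt.comp z (f := fun z : ℂ => z + (x : ℂ)) (differentiableAt_sincSq hz')
    (by fun_prop)).differentiableWithinAt

theorem exists_cut_bounds : ∃ K : ℝ, 0 < K ∧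
    DifferentiableOn ℂ cutL {z | 0 < z.im} ∧ DifferentiableOn ℂ cutR {z | 0 < z.im} ∧
    (∀ z : ℂ, 0 < z.im → Summable fun n : ℕ => sincSq (z - n)) ∧
    (∀ z : ℂ, 0 < z.im → Summable fun n : ℕ => sincSq (z + (n + 1))) ∧
    (∀ u : ℂ, 0 < u.im → ∀ s : ℝ, 0 ≤ s →
      ‖cutL (u - s)‖ ≤ K * cutBound u * (1 + s) ^ (-(1 / 2) : ℝ)) ∧
    (∀ u : ℂ, 0 < u.im → ∀ s : ℝ, 0 ≤ s →
      ‖cutR (u + s)‖ ≤ K * cutBound u * (1 + s) ^ (-(1 / 2) : ℝ)) := by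
  set a : ℕ → ℝ := fun n => (1 + (n : ℝ)) ^ (-(3 / 2) : ℝ) with ha
  have ha0 : ∀ n, 0 ≤ a n := fun n => by positivity
  -- The shift `s` goes into the terms and its decay into `Φ`; the case `s = 0` yields holomorphy
  -- and summability.
  have hL : ∀ s : ℝ, 0 ≤ s → _ := fun s hs => tsum_of_dominated isOpen_im_pos
    (T := fun n z => sincSq (z + ((-(s + n) : ℝ) : ℂ)))
    (Φ := fun z => 4 * cutBound z * (1 + s) ^ (-(1 / 2) : ℝ)) summable_rpow_three_halves ha0
    (fun n => differentiableOn_sincSq_add _)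
    (by have := continuous_cutBound; fun_prop) (fun n z hz => by
      refine (norm_sincSq_add_le hz _).trans ?_
      have := one_div_sq_le s hs n
      rw [abs_neg, abs_of_nonneg (by positivity), div_eq_mul_one_div]
      calc _ ≤ 4 * Real.exp (2 * Real.pi * z.im) * (1 + ‖z‖) ^ 2 * _ :=
            mul_le_mul_of_nonneg_left this (by positivity)
        _ = _ := by rw [cutBound]; ring)
  have hR : ∀ s : ℝ, 0 ≤ s → _ := fun s hs => tsum_of_dominated isOpen_im_pos
    (T := fun n z => sincSq (z + ((s + (n + 1) : ℝ) : ℂ)))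
    (Φ := fun z => 4 * cutBound z * (1 + s) ^ (-(1 / 2) : ℝ)) summable_rpow_three_halves ha0
    (fun n => differentiableOn_sincSq_add _)
    (by have := continuous_cutBound; fun_prop) (fun n z hz => by
      refine (norm_sincSq_add_le hz _).trans ?_
      have := one_div_sq_le s hs n
      rw [abs_of_nonneg (by positivity), div_eq_mul_one_div]
      have h2 : 1 / (1 + (s + ((n : ℝ) + 1))) ^ 2 ≤ 1 / (1 + (s + n)) ^ 2 := by
        gcongr; linarith
      calc _ ≤ 4 * Real.exp (2 * Real.pi * z.im) * (1 + ‖z‖) ^ 2 * _ :=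
            mul_le_mul_of_nonneg_left (h2.trans this) (by positivity)
        _ = _ := by rw [cutBound]; ring)
  have hpos : 0 < ∑' n, a n := summable_rpow_three_halves.tsum_pos ha0 0 (by simp)
  refine ⟨4 * ∑' n, a n, by positivity, ?_, ?_, fun z hz => ?_, fun z hz => ?_,
    fun u hu s hs => ?_, fun u hu s hs => ?_⟩
  · refine (hL 0 le_rfl).1.congr fun z hz => ?_
    simp [cutL, sub_eq_add_neg]
  · refine (hR 0 le_rfl).1.congr fun z hz => ?_
    simp [cutR]
  · refine ((hL 0 le_rfl).2.1 z hz).congr fun n => ?_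
    simp [sub_eq_add_neg]
  · refine ((hR 0 le_rfl).2.1 z hz).congr fun n => ?_
    simp
  · refine (le_of_eq ?_).trans (((hL s hs).2.2 u hu).trans (le_of_eq (by ring)))
    simp only [cutL]
    congr 2; ext n; congr 1; push_cast; ring
  · refine (le_of_eq ?_).trans (((hR s hs).2.2 u hu).trans (le_of_eq (by ring)))
    simp only [cutR]
    congr 2; ext n; congr 1; push_cast; ring

/-- The differentiated partial fraction expansion of the cotangent, `(π / sin πz)² = Σ 1 / (z +
n)²`, together with the invariance of `sin²(πz)` under integer shifts. -/
theorem cutL_add_cutR {z : ℂ} (hz : 0 < z.im) : cutL z + cutR z = 1 := by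
  obtain ⟨-, -, -, -, s1, s2, -, -⟩ := exists_cut_bounds
  have h := iteratedDerivWithin_cot_pi_mul_eq_mul_tsum_div_pow le_rfl hz
  have hsin : Complex.sin (Real.pi * z) ≠ 0 :=
    sin_pi_mul_ne_zero (UpperHalfPlane.coe_mem_integerComplement ⟨z, hz⟩)
  have hd : HasDerivAt (fun x : ℂ => Real.pi * Complex.cot (Real.pi * x))
      (-(Real.pi / Complex.sin (Real.pi * z)) ^ 2) z := by
    have h1 : HasDerivAt (fun x : ℂ => (Real.pi : ℂ) * x) Real.pi z := by
      simpa using (hasDerivAt_id z).const_mul (Real.pi : ℂ)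
    have h2 := ((h1.ccos.div h1.csin hsin)).const_mul (Real.pi : ℂ)
    refine h2.congr_deriv ?_
    field_simp
    linear_combination (-1 : ℂ) * Complex.sin_sq_add_cos_sq (Real.pi * z)
  rw [iteratedDerivWithin_one, (hd.hasDerivWithinAt).derivWithin
    (isOpen_upperHalfPlaneSet.uniqueDiffOn z hz)] at h
  have h' : (Real.pi / Complex.sin (Real.pi * z)) ^ 2 = ∑' n : ℤ, 1 / (z + n) ^ 2 := by
    have := neg_eq_iff_eq_neg.1 h
    simpa using this
  have hterm : ∀ n : ℤ, sincSq (z - n) =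
      (Complex.sin (Real.pi * z) / Real.pi) ^ 2 * (1 / (z - n) ^ 2) := fun n => by
    have hs : Complex.sin (Real.pi * (z - n)) ^ 2 = Complex.sin (Real.pi * z) ^ 2 := by
      have h1 := Complex.cos_two_mul (Real.pi * (z - n))
      have h2 := Complex.cos_two_mul (Real.pi * z)
      rw [show 2 * ((Real.pi : ℂ) * (z - n)) = 2 * (Real.pi * z) - n * (2 * Real.pi) by ring,
        Complex.cos_sub_int_mul_two_pi, h2] at h1
      linear_combination (1 / 2 : ℂ) * h1 + Complex.sin_sq_add_cos_sq (Real.pi * (z - n)) -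
        Complex.sin_sq_add_cos_sq (Real.pi * z)
    rw [sincSq, div_pow, hs, mul_pow, div_pow]
    field_simp
  have hsum : ∑' n : ℤ, sincSq (z - n) = 1 := by
    simp_rw [hterm]
    rw [tsum_mul_left, ← (Equiv.neg ℤ).tsum_eq]
    simp only [Equiv.neg_apply, Int.cast_neg, sub_neg_eq_add]
    rw [← h', ← mul_pow]
    have := Complex.ofReal_ne_zero.2 Real.pi_ne_zero
    field_simp
  rw [← hsum, tsum_of_nat_of_neg_add_one (f := fun n : ℤ => sincSq (z - n))]
  · simp only [cutL, cutR]
    congr 1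
    refine tsum_congr fun n => ?_
    congr 1; push_cast; ring
  · simpa using s1 z hz
  · refine (s2 z hz).congr fun n => ?_
    congr 1; push_cast; ring

/-! ### A holomorphic partition of unity with arbitrary polynomial decay -/

theorem norm_geom_sum_le {y : ℂ} {Y : ℝ} (hY : 1 ≤ Y) (hy : ‖y‖ ≤ Y) (M : ℕ) :
    ‖∑ i ∈ Finset.range M, y ^ i‖ ≤ M * Y ^ M := by
  refine (norm_sum_le _ _).trans ?_
  have : ∀ i ∈ Finset.range M, ‖y ^ i‖ ≤ Y ^ M := fun i hi => by
    rw [norm_pow]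
    exact (pow_le_pow_left₀ (norm_nonneg y) hy i).trans
      (pow_le_pow_right₀ hY (Finset.mem_range.1 hi).le)
  simpa using Finset.sum_le_sum this

/-- The polynomial `1 - (1 - x ^ M) ^ M` vanishes to order `M` at `0`, and takes the value `1` to
order `M` at `1`. -/
theorem norm_smoothstep_le {a b : ℂ} (hab : a + b = 1) {D t : ℝ} (hD : 1 ≤ D) (ht : 0 ≤ t)
    {M : ℕ} :
    (‖a‖ ≤ D * t → ‖a‖ ≤ D →
      ‖1 - (1 - a ^ M) ^ M‖ ≤ M * 2 ^ M * D ^ (M * M + M) * t ^ M) ∧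
    (‖b‖ ≤ D * t → ‖a‖ ≤ D → ‖(1 - a ^ M) ^ M‖ ≤ M ^ M * D ^ (M * M + M) * t ^ M) := by
  constructor
  · intro h1 h2
    have hDM : 1 ≤ D ^ M := one_le_pow₀ hD
    have e : 1 - (1 - a ^ M) ^ M = a ^ M * ∑ i ∈ Finset.range M, (1 - a ^ M) ^ i := by
      have := mul_neg_geom_sum (1 - a ^ M) M
      rw [← this]; ring
    have hy : ‖1 - a ^ M‖ ≤ 2 * D ^ M := by
      refine (norm_sub_le _ _).trans ?_
      rw [norm_one, norm_pow]
      have := pow_le_pow_left₀ (norm_nonneg a) h2 M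
      linarith
    have h3 := norm_geom_sum_le (by linarith) hy M
    rw [e, norm_mul, norm_pow]
    calc _ ≤ (D * t) ^ M * (M * (2 * D ^ M) ^ M) := by gcongr
      _ = _ := by rw [mul_pow, mul_pow, ← pow_mul, pow_add]; ring
  · intro h1 h2
    have e : 1 - a ^ M = b * ∑ i ∈ Finset.range M, a ^ i := by
      rw [← mul_neg_geom_sum, ← hab]; ring
    have h3 := norm_geom_sum_le hD h2 M
    rw [e, norm_pow, norm_mul]
    calc _ ≤ (D * t * (M * D ^ M)) ^ M := by gcongr
      _ = _ := by rw [mul_pow, mul_pow, mul_pow, ← pow_mul, pow_add]; ring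

/-- A holomorphic partition of unity `W + V = 1` on the upper half-plane, with `W` small to the left
and `V` small to the right, and with exponential growth in the vertical direction. -/
theorem exists_cutoff (N : ℕ) : ∃ (W V : ℂ → ℂ) (C c : ℝ) (A : ℕ), 0 < C ∧ 0 < c ∧
    DifferentiableOn ℂ W {z | 0 < z.im} ∧ DifferentiableOn ℂ V {z | 0 < z.im} ∧
    (∀ z, W z + V z = 1) ∧
    (∀ u : ℂ, 0 < u.im → ∀ s : ℝ, 0 ≤ s →
      ‖W (u - s)‖ ≤ C * Real.exp (c * u.im) * (1 + ‖u‖) ^ A / (1 + s) ^ N) ∧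
    (∀ u : ℂ, 0 < u.im → ∀ s : ℝ, 0 ≤ s →
      ‖V (u + s)‖ ≤ C * Real.exp (c * u.im) * (1 + ‖u‖) ^ A / (1 + s) ^ N) := by
  obtain ⟨K, hK, dL, dR, -, -, bL, bR⟩ := exists_cut_bounds
  -- The half-sums are only known to decay like `(1 + s)^(-1/2)`; vanishing to order `M` raises this
  -- to `(1 + s)^(-(N + 1))`.
  set M : ℕ := 2 * (N + 1) with hM
  set P : ℕ := M * M + M with hP
  have hMpos : 0 < (M : ℝ) := by rw [hM]; positivity
  have expand : ∀ u : ℂ, ((K + 1) * cutBound u) ^ P =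
      (K + 1) ^ P * Real.exp (P * (2 * Real.pi) * u.im) * (1 + ‖u‖) ^ (2 * P) := fun u => by
    rw [cutBound, mul_pow, mul_pow, ← Real.exp_nat_mul, ← pow_mul]; ring_nf
  have ht : ∀ s : ℝ, 0 ≤ s → ((1 + s) ^ (-(1 / 2) : ℝ)) ^ M ≤ 1 / (1 + s) ^ N := fun s hs => by
    have e : 1 / (1 + s) ^ N = (1 + s) ^ (-(N : ℝ)) := by
      rw [Real.rpow_neg (by positivity), Real.rpow_natCast, one_div]
    rw [e, ← Real.rpow_natCast, ← Real.rpow_mul (by positivity)]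
    refine Real.rpow_le_rpow_of_exponent_le (by linarith) ?_
    rw [hM]; push_cast; linarith
  have ht1 : ∀ s : ℝ, 0 ≤ s → (1 + s) ^ (-(1 / 2) : ℝ) ≤ 1 := fun s hs =>
    Real.rpow_le_one_of_one_le_of_nonpos (by linarith) (by norm_num)
  have hE : ∀ u : ℂ, 0 < u.im → 1 ≤ (K + 1) * cutBound u := fun u hu =>
    one_le_mul_of_one_le_of_one_le (by linarith) (one_le_cutBound hu)
  have hKE : ∀ u : ℂ, 0 < u.im → K * cutBound u + 1 ≤ (K + 1) * cutBound u := fun u hu => by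
    have := one_le_cutBound hu
    linarith
  have hpiP : 0 < (P : ℝ) * (2 * Real.pi) := by
    have := Real.pi_pos
    rw [hP]; push_cast; positivity
  refine ⟨fun z => 1 - (1 - cutL z ^ M) ^ M, fun z => (1 - cutL z ^ M) ^ M,
    (M * 2 ^ M + M ^ M) * (K + 1) ^ P, P * (2 * Real.pi), 2 * P, by positivity, hpiP,
    ?_, ?_, fun z => by ring, fun u hu s hs => ?_, fun u hu s hs => ?_⟩
  · exact (differentiableOn_const _).sub (((differentiableOn_const _).sub (dL.pow M)).pow M)
  · exact ((differentiableOn_const _).sub (dL.pow M)).pow M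
  · have hus : 0 < (u - (s : ℂ)).im := by simpa using hu
    have hb := bL u hu s hs
    have t0 : 0 ≤ (1 + s) ^ (-(1 / 2) : ℝ) := by positivity
    have hc := one_le_cutBound hu
    have h1 : ‖cutL (u - s)‖ ≤ (K + 1) * cutBound u * (1 + s) ^ (-(1 / 2) : ℝ) :=
      hb.trans (mul_le_mul_of_nonneg_right (by have := hKE u hu; linarith) t0)
    have h2 : ‖cutL (u - s)‖ ≤ (K + 1) * cutBound u :=
      h1.trans (mul_le_of_le_one_right (by positivity) (ht1 s hs))
    have := (norm_smoothstep_le (cutL_add_cutR hus) (hE u hu) t0 (M := M)).1 h1 h2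
    refine this.trans ?_
    rw [expand, div_eq_mul_one_div _ ((1 + s) ^ N)]
    refine mul_le_mul ?_ (ht s hs) (by positivity) (by positivity)
    have : 0 ≤ (M : ℝ) ^ M * ((K + 1) ^ P * Real.exp (P * (2 * Real.pi) * u.im) *
      (1 + ‖u‖) ^ (2 * P)) := by positivity
    linarith
  · have hus : 0 < (u + (s : ℂ)).im := by simpa using hu
    have hb := bR u hu s hs
    have t0 : 0 ≤ (1 + s) ^ (-(1 / 2) : ℝ) := by positivity
    have hc := one_le_cutBound hu
    have h1 : ‖cutR (u + s)‖ ≤ (K + 1) * cutBound u * (1 + s) ^ (-(1 / 2) : ℝ) :=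
      hb.trans (mul_le_mul_of_nonneg_right (by have := hKE u hu; linarith) t0)
    -- To the right `cutL` is close to `1` rather than small; it is bounded through `1 - cutR`.
    have h2 : ‖cutL (u + s)‖ ≤ (K + 1) * cutBound u := by
      rw [eq_sub_of_add_eq (cutL_add_cutR hus)]
      refine (norm_sub_le _ _).trans ?_
      have h3 := mul_le_of_le_one_right (by positivity : 0 ≤ K * cutBound u) (ht1 s hs)
      have := hKE u hu
      rw [norm_one]
      linarith
    have := (norm_smoothstep_le (cutL_add_cutR hus) (hE u hu) t0 (M := M)).2 h1 h2
    refine this.trans ?_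
    rw [expand, div_eq_mul_one_div _ ((1 + s) ^ N)]
    refine mul_le_mul ?_ (ht s hs) (by positivity) (by positivity)
    have : 0 ≤ (M : ℝ) * 2 ^ M * ((K + 1) ^ P * Real.exp (P * (2 * Real.pi) * u.im) *
      (1 + ‖u‖) ^ (2 * P)) := by positivity
    linarith

/-! ### Moderate growth in terms of hyperbolic distance -/

/-- The function `(1 + |z|²) / Im z`, which is `2 cosh` of the hyperbolic distance to `i`. -/
def hypB (z : ℂ) : ℝ := (1 + ‖z‖ ^ 2) / z.im

theorem im_le_norm (z : ℂ) : z.im ≤ ‖z‖ := (le_abs_self _).trans (Complex.abs_im_le_norm z)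

section hypB

variable {z : ℂ} (hz : 0 < z.im)
include hz

theorem norm_le_hypB : ‖z‖ ≤ hypB z := by
  rw [hypB, le_div_iff₀ hz]
  nlinarith [im_le_norm z, norm_nonneg z]

theorem im_le_hypB : z.im ≤ hypB z := (im_le_norm z).trans (norm_le_hypB hz)

theorem one_le_hypB : 1 ≤ hypB z := by
  rw [hypB, le_div_iff₀ hz]
  nlinarith [im_le_norm z, norm_nonneg z, sq_nonneg (‖z‖ - 1)]

theorem inv_im_le_hypB : (z.im)⁻¹ ≤ hypB z := by
  rw [hypB, inv_eq_one_div]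
  gcongr
  nlinarith [norm_nonneg z]

theorem hypB_add_real_le (x : ℝ) : hypB (z + x) ≤ 2 * (1 + |x|) ^ 2 * hypB z := by
  have him : (z + (x : ℂ)).im = z.im := by simp
  have hn : ‖z + x‖ ≤ ‖z‖ + |x| := by simpa using norm_add_le z (x : ℂ)
  rw [hypB, hypB, him, ← mul_div_assoc]
  gcongr
  have h1 : ‖z + x‖ ^ 2 ≤ (‖z‖ + |x|) ^ 2 := by gcongr
  have := norm_nonneg z
  have h2 := abs_nonneg x
  nlinarith [sq_nonneg (‖z‖ - |x|), mul_nonneg h2 (sq_nonneg ‖z‖), mul_nonneg (sq_nonneg |x|) (sq_nonneg ‖z‖)]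

end hypB

theorem continuousOn_hypB : ContinuousOn hypB {z | 0 < z.im} := by
  unfold hypB
  refine ContinuousOn.div (by fun_prop) Complex.continuous_im.continuousOn fun z hz => ne_of_gt hz

/-- Holomorphic functions on the upper half-plane which are bounded by a power of `hypB`. -/
def ModerateGrowth (f : ℂ → ℂ) : Prop :=
  DifferentiableOn ℂ f {z | 0 < z.im} ∧
    ∃ (C : ℝ) (N : ℕ), 0 < C ∧ ∀ z : ℂ, 0 < z.im → ‖f z‖ ≤ C * hypB z ^ N

/-! ### Solving the difference equation up to a small exponential factor -/

/-- The difference equation `f(z + 1) - ε f(z) = g(z)` has solutions of moderate growth up to a factor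
`exp (c δ y)`, with constants polynomial in `1 / δ`. -/
theorem exists_solution_exp_growth {g : ℂ → ℂ} (hg : ModerateGrowth g) {ε : ℂ} (hε : ‖ε‖ = 1) :
    ∃ (C c : ℝ) (A : ℕ), 0 < C ∧ 0 < c ∧ ∀ δ : ℝ, 0 < δ → δ ≤ 1 → ∃ f : ℂ → ℂ,
      DifferentiableOn ℂ f {z | 0 < z.im} ∧
      (∀ z : ℂ, 0 < z.im → f (z + 1) - ε * f z = g z) ∧
      ∀ z : ℂ, 0 < z.im → ‖f z‖ ≤ C * (δ⁻¹) ^ A * Real.exp (c * δ * z.im) * hypB z ^ A := by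
  obtain ⟨dg, C₀, M, hC₀, bg⟩ := hg
  -- A shift by `n` costs `(1 + n)^(2M)` in the bound for `g`; the two further powers leave the
  -- summable `1 / (1 + n)²`.
  set N := 2 * M + 2 with hN
  obtain ⟨W, V, C, c, A, hC, hc, dW, dV, hWV, bW, bV⟩ := exists_cutoff N
  set a : ℕ → ℝ := fun n => 1 / ((1 : ℝ) + n) ^ 2 with ha
  have sa : Summable a := summable_one_div_nat_add_one_sq
  have ha0 : ∀ n, 0 ≤ a n := fun n => by positivity
  have apos : 0 < ∑' n, a n := sa.tsum_pos ha0 0 (by simp [ha])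
  have ε0 : ε ≠ 0 := by rintro rfl; simp at hε
  set Q := M + A + N with hQ
  set C₁ : ℝ := C₀ * 8 ^ M * C * 2 ^ A with hC₁
  have hC₁pos : 0 < C₁ := by positivity
  refine ⟨2 * C₁ * ∑' n, a n, c, Q, by positivity, hc, fun δ hδ hδ1 => ?_⟩
  have scale : ∀ {z : ℂ}, 0 < z.im → 0 < ((δ : ℂ) * z).im := fun {z} hz => by
    simpa using mul_pos hδ hz
  have dWδ : DifferentiableOn ℂ (fun z => W (δ * z)) {z | 0 < z.im} :=
    dW.comp (by fun_prop) fun z hz => scale hz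
  have dVδ : DifferentiableOn ℂ (fun z => V (δ * z)) {z | 0 < z.im} :=
    dV.comp (by fun_prop) fun z hz => scale hz
  set Φ : ℂ → ℝ := fun z => C₁ * (δ⁻¹) ^ Q * Real.exp (c * δ * z.im) * hypB z ^ Q with hΦ
  have cΦ : ContinuousOn Φ {z | 0 < z.im} := by
    have := continuousOn_hypB
    have h2 : ContinuousOn (fun z : ℂ => C₁ * (δ⁻¹) ^ Q * Real.exp (c * δ * z.im)) {z | 0 < z.im} := by
      have := Complex.continuous_im
      fun_prop
    exact h2.mul (this.pow Q)
  -- Common majorant for both series. The weaker denominator `δ (1 + n)` serves both: for the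
  -- right-hand one, `1 + δ n ≥ δ (1 + n)` because `δ ≤ 1`.
  have main : ∀ (n : ℕ) (x : ℝ) (w : ℂ) (z : ℂ), 0 < z.im → |x| ≤ 1 + n →
      ‖w‖ ≤ C * Real.exp (c * (δ * z).im) * (1 + ‖(δ : ℂ) * z‖) ^ A / (δ * (1 + n)) ^ N →
      ‖g (z + x) * w‖ ≤ Φ z * a n := by
    intro n x w z hz hx hw
    have hn : (0 : ℝ) ≤ n := n.cast_nonneg
    have h1 := one_le_hypB hz
    have e1 : ‖g (z + x)‖ ≤ C₀ * (8 * (1 + (n : ℝ)) ^ 2 * hypB z) ^ M := by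
      have hzx : 0 < (z + (x : ℂ)).im := by simpa using hz
      refine (bg _ hzx).trans ?_
      have hb0 := one_le_hypB hzx
      gcongr
      refine (hypB_add_real_le hz x).trans (mul_le_mul_of_nonneg_right ?_ (by linarith))
      have : (1 + |x|) ^ 2 ≤ (2 * (1 + (n : ℝ))) ^ 2 :=
        pow_le_pow_left₀ (by positivity) (by linarith) 2
      nlinarith
    have e2 : ‖w‖ ≤ C * Real.exp (c * δ * z.im) * (2 * hypB z) ^ A / (δ * (1 + n)) ^ N := by
      refine hw.trans ?_
      have : (δ * z).im = δ * z.im := by simp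
      rw [this, mul_assoc c]
      gcongr
      have : ‖(δ : ℂ) * z‖ = δ * ‖z‖ := by simp [abs_of_pos hδ]
      rw [this]
      have h3 := mul_le_mul_of_nonneg_right hδ1 (norm_nonneg z)
      have h4 := norm_le_hypB hz
      linarith
    rw [norm_mul]
    have hδi : 1 ≤ δ⁻¹ := (one_le_inv₀ hδ).2 hδ1
    calc _ ≤ C₀ * (8 * (1 + (n : ℝ)) ^ 2 * hypB z) ^ M *
          (C * Real.exp (c * δ * z.im) * (2 * hypB z) ^ A / (δ * (1 + n)) ^ N) := by gcongr
      _ = C₁ * (δ⁻¹) ^ N * Real.exp (c * δ * z.im) * hypB z ^ (M + A) * a n := by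
        rw [ha, hC₁, hN]
        simp only [mul_pow, inv_pow, ← pow_mul]
        field_simp
        ring
      _ ≤ C₁ * (δ⁻¹) ^ Q * Real.exp (c * δ * z.im) * hypB z ^ Q * a n := by
        gcongr <;> first | assumption | omega
  have bL : ∀ (n : ℕ) (z : ℂ), z ∈ {z : ℂ | 0 < z.im} →
      ‖ε ^ n * (g (z - (1 + n)) * W (δ * (z - (1 + n))))‖ ≤ Φ z * a n := by
    intro n z hz
    rw [norm_mul, norm_pow, hε, one_pow, one_mul]
    have hn : (0 : ℝ) ≤ n := n.cast_nonneg
    have h := main n (-(1 + n)) (W (δ * (z - (1 + n)))) z hz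
      (by rw [abs_neg, abs_of_nonneg (by positivity)]) ?_
    · convert h using 4
      push_cast; ring
    · have := bW (δ * z) (scale hz) (δ * (1 + n)) (by positivity)
      rw [show (δ : ℂ) * (z - (1 + n)) = δ * z - ((δ * (1 + n) : ℝ) : ℂ) by push_cast; ring]
      refine this.trans ?_
      gcongr
      linarith
  have bR : ∀ (n : ℕ) (z : ℂ), z ∈ {z : ℂ | 0 < z.im} →
      ‖(ε⁻¹) ^ (n + 1) * (g (z + n) * V (δ * (z + n)))‖ ≤ Φ z * a n := by
    intro n z hz
    rw [norm_mul, norm_pow, norm_inv, hε, inv_one, one_pow, one_mul]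
    have hn : (0 : ℝ) ≤ n := n.cast_nonneg
    have h := main n n (V (δ * (z + n))) z hz
      (by rw [abs_of_nonneg (by positivity)]; linarith) ?_
    · simpa using h
    · have := bV (δ * z) (scale hz) (δ * n) (by positivity)
      rw [show (δ : ℂ) * (z + n) = δ * z + ((δ * n : ℝ) : ℂ) by push_cast; ring]
      refine this.trans ?_
      gcongr
      linarith
  have shift : ∀ x : ℝ, ∀ z ∈ {z : ℂ | 0 < z.im}, z + (x : ℂ) ∈ {z : ℂ | 0 < z.im} :=
    fun x z hz => by simpa using hz
  obtain ⟨dS1, sS1, bS1⟩ := tsum_of_dominated isOpen_im_pos sa ha0 (fun n => by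
    have h := (dg.mul dWδ).comp (f := fun z : ℂ => z + ((-(1 + n) : ℝ) : ℂ)) (by fun_prop)
      (shift _)
    refine (h.const_mul (ε ^ n)).congr fun z _ => ?_
    simp [sub_eq_add_neg]) cΦ bL
  obtain ⟨dS2, sS2, bS2⟩ := tsum_of_dominated isOpen_im_pos sa ha0 (fun n => by
    have h := (dg.mul dVδ).comp (f := fun z : ℂ => z + ((n : ℝ) : ℂ)) (by fun_prop)
      (shift _)
    refine (h.const_mul ((ε⁻¹) ^ (n + 1))).congr fun z _ => ?_
    simp) cΦ bR
  -- Both series telescope: `S₁(z + 1) - ε S₁(z) = gW` and `S₂(z + 1) - ε S₂(z) = -gV`, with cutoffs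
  -- taken at `δz`, so `S₁ - S₂` produces `g (W + V) = g`.
  refine ⟨_, dS1.sub dS2, fun z hz => ?_, fun z hz => ?_⟩
  · have hz1 : z + 1 ∈ {z : ℂ | 0 < z.im} := by simpa using shift 1 z hz
    have r1 := (sS1 _ hz1).tsum_eq_zero_add
    have r2 := (sS2 _ hz).tsum_eq_zero_add
    have t1 : ∀ n : ℕ, ε ^ (n + 1) * (g (z + 1 - (1 + ((n + 1 : ℕ) : ℂ))) *
        W (δ * (z + 1 - (1 + ((n + 1 : ℕ) : ℂ))))) =
        ε * (ε ^ n * (g (z - (1 + n)) * W (δ * (z - (1 + n))))) := fun n => by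
      rw [show z + 1 - (1 + ((n + 1 : ℕ) : ℂ)) = z - (1 + n) by push_cast; ring]; ring
    have t2 : ∀ n : ℕ, (ε⁻¹) ^ (n + 1) * (g (z + 1 + n) * V (δ * (z + 1 + n))) =
        ε * ((ε⁻¹) ^ (n + 1 + 1) * (g (z + ((n + 1 : ℕ) : ℂ)) * V (δ * (z + ((n + 1 : ℕ) : ℂ))))) :=
      fun n => by
        rw [show z + ((n + 1 : ℕ) : ℂ) = z + 1 + n by push_cast; ring, pow_succ _ (n + 1)]
        field_simp
    simp only [Pi.sub_apply]
    rw [r1, r2]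
    simp_rw [t1, t2]
    rw [tsum_mul_left, tsum_mul_left]
    have := hWV (δ * z)
    simp only [pow_zero, Nat.cast_zero, add_zero, one_mul, add_sub_cancel_right, zero_add, pow_one]
    linear_combination (g z) * this + (V (δ * z) * g z) * (mul_inv_cancel₀ ε0)
  · simp only [Pi.sub_apply]
    refine (norm_sub_le _ _).trans ?_
    have h1 := bS1 z hz
    have h2 := bS2 z hz
    calc _ ≤ Φ z * (∑' n, a n) + Φ z * (∑' n, a n) := add_le_add h1 h2
      _ = _ := by rw [hΦ]; ring

/-! ### Removing the exponential factor by the maximum principle -/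

open Filter Topology Function in
/-- A maximum principle: if a holomorphic function on the upper half-plane picks up the factor
`exp (2 π i τ)`, `0 ≤ τ < 1`, under `z ↦ z + 1`, and grows slower than `exp (2 π (1 - τ) y)`, then on
`Im z ≥ 1` it is bounded by its maximum on `Im z = 1`. -/
theorem norm_le_of_quasiperiodic {p : ℂ → ℂ} (dp : DifferentiableOn ℂ p {z | 0 < z.im}) {τ : ℝ}
    (hτ : 0 ≤ τ) (hp : ∀ z : ℂ, 0 < z.im →
      p (z + 1) = Complex.exp (2 * Real.pi * Complex.I * τ) * p z)
    {C a D : ℝ} (ha : a < 2 * Real.pi * (1 - τ))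
    (hgrow : ∀ z : ℂ, 1 ≤ z.im → 0 ≤ z.re → z.re ≤ 1 → ‖p z‖ ≤ C * Real.exp (a * z.im))
    (hD : ∀ z : ℂ, z.im = 1 → 0 ≤ z.re → z.re ≤ 1 → ‖p z‖ ≤ D) {z : ℂ} (hz : 1 ≤ z.im) :
    ‖p z‖ ≤ D := by
  have hpi := Real.pi_pos
  -- Twisting by `exp(-2πiτz)` makes `p` periodic; the value `0` off the half-plane makes the
  -- periodicity hold on all of `ℂ`.
  set P : ℂ → ℂ := fun z => if 0 < z.im then p z * Complex.exp (-(2 * Real.pi * Complex.I * τ * z))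
    else 0 with hP
  have eP : ∀ z : ℂ, 0 < z.im → P z = p z * Complex.exp (-(2 * Real.pi * Complex.I * τ * z)) :=
    fun z hz => by simp [hP, hz]
  have nP : ∀ z : ℂ, 0 < z.im → ‖P z‖ = ‖p z‖ * Real.exp (2 * Real.pi * τ * z.im) := fun z hz => by
    rw [eP z hz, norm_mul, Complex.norm_exp]
    congr 2
    simp
  have perP : Periodic P ((1 : ℝ) : ℂ) := fun z => by
    by_cases h : 0 < z.im
    · have h1 : 0 < (z + ((1 : ℝ) : ℂ)).im := by simpa using h
      rw [eP _ h, eP _ h1, Complex.ofReal_one, hp z h, mul_comm (Complex.exp _) (p z), mul_assoc,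
        ← Complex.exp_add]
      congr 2
      ring
    · simp [hP, h]
  have dP : ∀ z : ℂ, 0 < z.im → DifferentiableAt ℂ P z := fun z hz => by
    have h1 : DifferentiableAt ℂ (fun z => p z * Complex.exp (-(2 * Real.pi * Complex.I * τ * z))) z :=
      (dp.differentiableAt (isOpen_im_pos.mem_nhds hz)).mul (by fun_prop)
    refine h1.congr_of_eventuallyEq ?_
    filter_upwards [isOpen_im_pos.mem_nhds hz] with w hw using eP w hw
  have red : ∀ z : ℂ, ∃ w : ℂ, w.im = z.im ∧ 0 ≤ w.re ∧ w.re ≤ 1 ∧ P w = P z := fun z => by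
    refine ⟨z - (⌊z.re⌋ : ℤ), by simp, by simp, ?_, ?_⟩
    · have := (Int.lt_floor_add_one z.re).le
      simp only [Complex.sub_re, Complex.intCast_re]; linarith
    · simpa using perP.sub_int_mul_eq (x := z) ⌊z.re⌋
  have growP : ∀ z : ℂ, 1 ≤ z.im → ‖P z‖ ≤ C * Real.exp ((a + 2 * Real.pi * τ) * z.im) := fun z hz => by
    obtain ⟨w, h1, h2, h3, h4⟩ := red z
    rw [← h4, nP w (by linarith), ← h1, add_mul, Real.exp_add, ← mul_assoc]
    exact mul_le_mul_of_nonneg_right (hgrow w (by linarith) h2 h3) (Real.exp_pos _).le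
  have ev : ∀ᶠ z in comap Complex.im atTop, 1 ≤ z.im :=
    tendsto_comap.eventually (eventually_ge_atTop 1)
  have hol : ∀ᶠ z in comap Complex.im atTop, DifferentiableAt ℂ P z :=
    ev.mono fun z hz => dP z (by linarith)
  have perE : Periodic (fun z : ℂ => Complex.exp (2 * Real.pi * Complex.I * z)) ((1 : ℝ) : ℂ) :=
    fun z => by
      simp only [Complex.ofReal_one, mul_add, mul_one, Complex.exp_add, Complex.exp_two_pi_mul_I]
  have hzero : ZeroAtFilter (comap Complex.im atTop)
      (fun z => Complex.exp (2 * Real.pi * Complex.I * z) * P z) := by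
    have hlim : Tendsto (fun z : ℂ => C * Real.exp (-((2 * Real.pi * (1 - τ) - a) * z.im)))
        (comap Complex.im atTop) (𝓝 0) := by
      have h1 : Tendsto (fun y : ℝ => C * Real.exp (-((2 * Real.pi * (1 - τ) - a) * y))) atTop
          (𝓝 (C * 0)) := by
        refine Tendsto.const_mul C (Real.tendsto_exp_neg_atTop_nhds_zero.comp ?_)
        exact tendsto_id.const_mul_atTop (by linarith)
      rw [mul_zero] at h1
      exact h1.comp tendsto_comap
    refine squeeze_zero_norm' (ev.mono fun z hz => ?_) hlim
    have e1 : ‖Complex.exp (2 * Real.pi * Complex.I * z)‖ = Real.exp (-(2 * Real.pi * z.im)) := by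
      rw [Complex.norm_exp]; simp
    rw [norm_mul, e1]
    calc _ ≤ Real.exp (-(2 * Real.pi * z.im)) * (C * Real.exp ((a + 2 * Real.pi * τ) * z.im)) :=
          mul_le_mul_of_nonneg_left (growP z hz) (Real.exp_pos _).le
      _ = _ := by
          rw [mul_left_comm, ← Real.exp_add]; ring_nf
  -- The function `q P` tends to `0` at `i∞`; being periodic and holomorphic there, it is then
  -- `O(|q|)`, so `P` is bounded and the singularity at `q = 0` is removable.
  have bdP : BoundedAtFilter (comap Complex.im atTop) P := by
    have h := Periodic.exp_decay_of_zero_at_inf one_pos (perE.mul perP)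
      (hol.mono fun z hz => by fun_prop) hzero
    obtain ⟨c, hc⟩ := h.bound
    refine Asymptotics.IsBigO.of_bound c (hc.mono fun z hz => ?_)
    have e1 : ‖Complex.exp (2 * Real.pi * Complex.I * z)‖ = Real.exp (-(2 * Real.pi * z.im)) := by
      rw [Complex.norm_exp]; simp
    simp only [Pi.mul_apply, norm_mul, e1, Real.norm_eq_abs, Real.abs_exp, div_one] at hz
    rw [show -2 * Real.pi * z.im = -(2 * Real.pi * z.im) by ring,
      mul_comm (Real.exp _)] at hz
    simpa using le_of_mul_le_mul_right hz (Real.exp_pos _)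
  set F := Periodic.cuspFunction 1 P with hF
  have FP : ∀ z, F (Periodic.qParam 1 z) = P z := Periodic.eq_cuspFunction one_ne_zero perP
  set r := Real.exp (-2 * Real.pi) with hr
  have rpos : 0 < r := Real.exp_pos _
  have nq : ∀ z, ‖Periodic.qParam 1 z‖ = Real.exp (-2 * Real.pi * z.im) := fun z => by
    simpa using Periodic.norm_qParam 1 z
  have qinv : ∀ q : ℂ, q ≠ 0 → ‖q‖ ≤ r →
      ∃ z : ℂ, Periodic.qParam 1 z = q ∧ 1 ≤ z.im ∧ (‖q‖ = r → z.im = 1) := fun q hq hqr => by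
    refine ⟨Periodic.invQParam 1 q, Periodic.qParam_right_inv one_ne_zero hq, ?_⟩
    have h := nq (Periodic.invQParam 1 q)
    rw [Periodic.qParam_right_inv one_ne_zero hq] at h
    rw [h, hr] at hqr ⊢
    constructor
    · have := Real.exp_le_exp.1 hqr
      nlinarith
    · intro h'
      have := Real.exp_injective h'
      have h2 : -2 * Real.pi * ((Periodic.invQParam 1 q).im - 1) = 0 := by linarith
      rcases mul_eq_zero.1 h2 with h3 | h3 <;> linarith
  have dF : ∀ q ∈ Metric.closedBall (0 : ℂ) r, DifferentiableAt ℂ F q := fun q hq => by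
    by_cases h0 : q = 0
    · rw [h0]
      exact Periodic.differentiableAt_cuspFunction_zero one_pos perP hol bdP
    · obtain ⟨z, rfl, h1, -⟩ := qinv q h0 (by simpa using hq)
      exact Periodic.differentiableAt_cuspFunction one_ne_zero perP (dP z (by linarith))
  -- The circle `|q| = exp(-2π)` is the image of the line `Im z = 1`.
  have hmax : ‖F (Periodic.qParam 1 z)‖ ≤ D * Real.exp (2 * Real.pi * τ) := by
    refine Complex.norm_le_of_forall_mem_frontier_norm_le (U := Metric.ball 0 r)
      Metric.isBounded_ball ?_ ?_ ?_
    · refine DifferentiableOn.diffContOnCl fun q hq => (dF q ?_).differentiableWithinAt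
      rwa [closure_ball _ rpos.ne'] at hq
    · intro q hq
      rw [frontier_ball _ rpos.ne', mem_sphere_zero_iff_norm] at hq
      have hq0 : q ≠ 0 := by rintro rfl; simp at hq; exact rpos.ne hq
      obtain ⟨u, rfl, -, h1⟩ := qinv q hq0 hq.le
      obtain ⟨w, h1', h2, h3, h4⟩ := red u
      rw [FP, ← h4]
      have hw : w.im = 1 := by rw [h1', h1 hq]
      rw [nP w (by linarith), hw, mul_one]
      exact mul_le_mul_of_nonneg_right (hD w hw h2 h3) (Real.exp_pos _).le
    · rw [closure_ball _ rpos.ne', mem_closedBall_zero_iff, nq, hr]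
      exact Real.exp_le_exp.2 (by nlinarith)
  rw [FP, nP z (by linarith)] at hmax
  have h1 : Real.exp (2 * Real.pi * τ) ≤ Real.exp (2 * Real.pi * τ * z.im) :=
    Real.exp_le_exp.2 (le_mul_of_one_le_right (by positivity) hz)
  have h2 := mul_le_mul_of_nonneg_left h1 (norm_nonneg (p z))
  exact le_of_mul_le_mul_right (h2.trans hmax) (Real.exp_pos _)

theorem exists_eq_exp_of_norm_eq_one {ε : ℂ} (hε : ‖ε‖ = 1) :
    ∃ τ : ℝ, 0 ≤ τ ∧ τ < 1 ∧ ε = Complex.exp (2 * Real.pi * Complex.I * τ) := by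
  set x := Complex.arg ε / (2 * Real.pi) with hx
  have h1 := Complex.norm_mul_exp_arg_mul_I ε
  have hpi := Real.pi_pos.ne'
  refine ⟨Int.fract x, Int.fract_nonneg x, Int.fract_lt_one x, ?_⟩
  rw [hε, Complex.ofReal_one, one_mul] at h1
  have h2 : 2 * Real.pi * Complex.I * ((Int.fract x : ℝ) : ℂ) =
      Complex.arg ε * Complex.I - (⌊x⌋ : ℤ) * (2 * Real.pi * Complex.I) := by
    rw [Int.fract, hx]
    push_cast
    have := Complex.ofReal_ne_zero.2 hpi
    field_simp
  rw [h2, Complex.exp_sub, h1, Complex.exp_int_mul_two_pi_mul_I, div_one]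

theorem hypB_le_of_strip {z : ℂ} (h : 1 ≤ z.im) (h0 : 0 ≤ z.re) (h1 : z.re ≤ 1) :
    hypB z ≤ 3 * z.im := by
  rw [hypB, div_le_iff₀ (by linarith), Complex.sq_norm, Complex.normSq_apply]
  nlinarith

/-- The difference equation `f(z + 1) - ε f(z) = g(z)`, `|ε| = 1`, is solvable within the holomorphic
functions of moderate growth. -/
theorem exists_moderate_solution {g : ℂ → ℂ} (hg : ModerateGrowth g) {ε : ℂ} (hε : ‖ε‖ = 1) :
    ∃ f : ℂ → ℂ, ModerateGrowth f ∧ ∀ z : ℂ, 0 < z.im → f (z + 1) - ε * f z = g z := by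
  obtain ⟨C, c, A, hC, hc, H⟩ := exists_solution_exp_growth hg hε
  obtain ⟨τ, hτ0, hτ1, hτ⟩ := exists_eq_exp_of_norm_eq_one hε
  have hpi := Real.pi_pos
  -- Half of the critical rate `2π(1 - τ)`: since `c δ₀ ≤ b`, there is room left to absorb powers of
  -- `y`.
  set b := Real.pi * (1 - τ) with hb
  have bpos : 0 < b := mul_pos hpi (by linarith)
  set δ₀ := min 1 (b / c) with hδ₀
  have δ₀pos : 0 < δ₀ := lt_min one_pos (div_pos bpos hc)
  have δ₀le : δ₀ ≤ 1 := min_le_left _ _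
  have cδ : c * δ₀ ≤ b := by
    have := mul_le_mul_of_nonneg_left (min_le_right 1 (b / c)) hc.le
    rwa [mul_div_cancel₀ _ hc.ne'] at this
  obtain ⟨f, df, ef, bf⟩ := H δ₀ δ₀pos δ₀le
  set E := C * (δ₀⁻¹) ^ A * Real.exp (c * δ₀) with hE
  have Epos : 0 < E := by positivity
  refine ⟨f, ⟨df, E + 2 * E * 3 ^ A, 2 * A, by positivity, fun z hz => ?_⟩, ef⟩
  have hB := one_le_hypB hz
  have hBA : 1 ≤ hypB z ^ A := one_le_pow₀ hB
  have hBA2 : hypB z ^ (2 * A) = hypB z ^ A * hypB z ^ A := by rw [two_mul, pow_add]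
  rcases le_total z.im 1 with hy | hy
  · have h1 : ‖f z‖ ≤ E * hypB z ^ A := by
      refine (bf z hz).trans ?_
      have : Real.exp (c * δ₀ * z.im) ≤ Real.exp (c * δ₀) :=
        Real.exp_le_exp.2 (mul_le_of_le_one_right (by positivity) hy)
      rw [hE]
      gcongr
    have h2 : E * hypB z ^ A ≤ E * hypB z ^ (2 * A) := by
      rw [hBA2]; gcongr; exact le_mul_of_one_le_right (by positivity) hBA
    have h3 : 0 ≤ 2 * E * 3 ^ A * hypB z ^ (2 * A) := by positivity
    linarith
  -- Adapted to the point: `c δ y = c δ₀` there, while `1/δ` is only linear in `y`.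
  · set δ := δ₀ / z.im with hδ
    have δpos : 0 < δ := div_pos δ₀pos hz
    have δle : δ ≤ δ₀ := div_le_self δ₀pos.le hy
    obtain ⟨f', df', ef', bf'⟩ := H δ δpos (δle.trans δ₀le)
    have hδi : δ₀⁻¹ ≤ δ⁻¹ := inv_anti₀ δpos δle
    have δi : (δ⁻¹) ^ A = (δ₀⁻¹) ^ A * z.im ^ A := by
      rw [hδ, inv_div, ← mul_pow]; congr 1; field_simp
    set G := C * (δ⁻¹) ^ A with hG
    have Gpos : 0 < G := by positivity
    have both : ∀ w : ℂ, 0 < w.im →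
        ‖(f - f') w‖ ≤ 2 * (G * Real.exp (c * δ₀ * w.im) * hypB w ^ A) := fun w hw => by
      have hBw := one_le_hypB hw
      have h1 : ‖f w‖ ≤ G * Real.exp (c * δ₀ * w.im) * hypB w ^ A := by
        refine (bf w hw).trans ?_
        rw [hG]; gcongr
      have h2 : ‖f' w‖ ≤ G * Real.exp (c * δ₀ * w.im) * hypB w ^ A := by
        refine (bf' w hw).trans ?_
        rw [hG]; gcongr
      rw [Pi.sub_apply]
      linarith [norm_sub_le (f w) (f' w)]
    have strip : ∀ w : ℂ, 1 ≤ w.im → 0 ≤ w.re → w.re ≤ 1 →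
        ‖(f - f') w‖ ≤ 2 * (G * Real.exp (c * δ₀ * w.im) * (3 * w.im) ^ A) := fun w h1 h2 h3 => by
      have hw : 0 < w.im := by linarith
      have hBw := one_le_hypB hw
      refine (both w hw).trans ?_
      gcongr
      exact hypB_le_of_strip h1 h2 h3
    have hmax : ‖(f - f') z‖ ≤ 2 * (G * Real.exp (c * δ₀) * 3 ^ A) := by
      -- The rate `b + b/2` is below `2b`; the extra `b/2` absorbs `(3y)^A` through `x^A / A! ≤ exp
      -- x`.
      refine norm_le_of_quasiperiodic (df.sub df') hτ0 (fun w hw => ?_)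
        (C := 2 * G * (3 * (b / 2)⁻¹) ^ A * A.factorial) (a := b + b / 2) (by linarith)
        (fun w h1 h2 h3 => ?_)
        (fun w h1 h2 h3 => ?_) hy
      · rw [← hτ, Pi.sub_apply, Pi.sub_apply]
        linear_combination ef w hw - ef' w hw
      · refine (strip w h1 h2 h3).trans ?_
        have hw0 : 0 < w.im := by linarith
        have h4 := Real.pow_div_factorial_le_exp (b / 2 * w.im) (by positivity) A
        rw [div_le_iff₀ (by positivity)] at h4
        have h5 : Real.exp (c * δ₀ * w.im) ≤ Real.exp (b * w.im) := by gcongr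
        have h6 : (3 * w.im) ^ A ≤
            (3 * (b / 2)⁻¹) ^ A * (Real.exp (b / 2 * w.im) * A.factorial) := by
          calc (3 * w.im) ^ A = (3 * (b / 2)⁻¹) ^ A * (b / 2 * w.im) ^ A := by
                rw [← mul_pow]; congr 1; field_simp
            _ ≤ _ := by gcongr
        calc _ ≤ 2 * (G * Real.exp (b * w.im) *
              ((3 * (b / 2)⁻¹) ^ A * (Real.exp (b / 2 * w.im) * A.factorial))) := by gcongr
          _ = _ := by rw [add_mul, Real.exp_add]; ring
      · have := strip w h1.ge h2 h3
        simpa [h1] using this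
    have hf' : ‖f' z‖ ≤ G * Real.exp (c * δ₀) * hypB z ^ A := by
      refine (bf' z hz).trans (le_of_eq ?_)
      rw [hδ, mul_assoc c, div_mul_cancel₀ _ hz.ne']
    have hGE : G * Real.exp (c * δ₀) ≤ E * hypB z ^ A := by
      calc G * Real.exp (c * δ₀) = E * z.im ^ A := by rw [hG, δi, hE]; ring
        _ ≤ _ := by gcongr; exact im_le_hypB hz
    have h1 : ‖f z‖ ≤ ‖f' z‖ + ‖(f - f') z‖ := by
      have := norm_add_le (f' z) ((f - f') z)
      simpa using this
    calc ‖f z‖ ≤ E * hypB z ^ A * hypB z ^ A + 2 * (E * hypB z ^ A * 3 ^ A) := by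
          refine h1.trans (add_le_add (hf'.trans ?_) (hmax.trans ?_)) <;> gcongr
      _ ≤ E * hypB z ^ A * hypB z ^ A + 2 * (E * hypB z ^ A * 3 ^ A) * hypB z ^ A := by
          exact add_le_add le_rfl (le_mul_of_one_le_right (by positivity) hBA)
      _ = _ := by rw [hBA2]; ring

/-! ### The space `ℙ` and moderate growth -/

theorem moderateGrowth_of_spaceP {g : ℍ → ℂ} (hg : g ∈ spaceP) : ModerateGrowth (g ∘ ofComplex) := by
  obtain ⟨dg, K, ρ, σ, hK, hρ, hσ, h⟩ := hg
  refine ⟨UpperHalfPlane.mdifferentiable_iff.1 dg, 2 * K, ⌈max ρ σ⌉₊, by positivity, fun z hz => ?_⟩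
  have hB := one_le_hypB hz
  rw [Function.comp_apply, ofComplex_apply_of_im_pos hz]
  have hN : max ρ σ ≤ ⌈max ρ σ⌉₊ := Nat.le_ceil _
  have mono : ∀ {x s : ℝ}, 0 ≤ x → x ≤ hypB z → 0 ≤ s → s ≤ max ρ σ →
      x ^ s ≤ hypB z ^ ⌈max ρ σ⌉₊ := fun {x s} hx hxB hs hsm => by
    rw [← Real.rpow_natCast]
    exact (Real.rpow_le_rpow hx hxB hs).trans
      (Real.rpow_le_rpow_of_exponent_le hB (hsm.trans hN))
  have h1 := mono (norm_nonneg z) (norm_le_hypB hz) hρ.le (le_max_left _ _)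
  have h2 := mono (inv_nonneg.2 hz.le) (inv_im_le_hypB hz) hσ.le (le_max_right _ _)
  rw [Real.inv_rpow hz.le, ← Real.rpow_neg hz.le] at h2
  have h3 := (h ⟨z, hz⟩).le
  refine h3.trans ?_
  have h4 : ‖((⟨z, hz⟩ : ℍ) : ℂ)‖ ^ ρ + (⟨z, hz⟩ : ℍ).im ^ (-σ) ≤ 2 * hypB z ^ ⌈max ρ σ⌉₊ := by
    have := add_le_add h1 h2
    rw [← two_mul] at this
    exact this
  calc _ ≤ K * (2 * hypB z ^ ⌈max ρ σ⌉₊) := mul_le_mul_of_nonneg_left h4 hK.le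
    _ = _ := by ring

theorem spaceP_of_moderateGrowth {f : ℂ → ℂ} (hf : ModerateGrowth f) :
    (fun z : ℍ => f z) ∈ spaceP := by
  obtain ⟨df, C, N, hC, h⟩ := hf
  -- Passing to `N + 1` keeps the exponents positive when `N = 0`; the summand `1` in the constant
  -- makes the inequality strict.
  refine ⟨UpperHalfPlane.mdifferentiable_iff.2 (df.congr fun z hz => ?_),
    2 * C * 4 ^ (N + 1) + 1, (4 * (N + 1) : ℕ), (2 * (N + 1) : ℕ), by positivity, by positivity,
    by positivity, fun z => ?_⟩
  · simp [ofComplex_apply_of_im_pos hz]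
  · have hz : 0 < (z : ℂ).im := z.im_pos
    have him : z.im = (z : ℂ).im := rfl
    have hB := one_le_hypB hz
    set r := ‖(z : ℂ)‖ with hr
    have hr0 : 0 ≤ r := norm_nonneg _
    rw [Real.rpow_neg z.im_pos.le, Real.rpow_natCast, Real.rpow_natCast, him, ← inv_pow]
    set t := ((z : ℂ).im)⁻¹ with ht
    have ht0 : 0 < t := inv_pos.2 hz
    set X := r ^ (4 * (N + 1)) + t ^ (2 * (N + 1)) with hX
    have hX1 : 1 ≤ X := by
      rcases le_total 1 r with h1 | h1
      · have := one_le_pow₀ h1 (n := 4 * (N + 1))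
        have : 0 ≤ t ^ (2 * (N + 1)) := by positivity
        linarith
      · have h2 : 1 ≤ t := (one_le_inv₀ hz).2 ((im_le_norm _).trans h1)
        have := one_le_pow₀ h2 (n := 2 * (N + 1))
        have : 0 ≤ r ^ (4 * (N + 1)) := by positivity
        linarith
    have hBX : hypB z ^ (N + 1) ≤ 4 ^ (N + 1) * (2 * X) := by
      have e : hypB z = (1 + r ^ 2) * t := by rw [hypB, div_eq_mul_inv]
      -- The product `(1 + r²)^(N+1) t^(N+1)` is separated into a sum by the arithmetic-geometric
      -- mean inequality, which doubles the exponents.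
      have h1 : hypB z ^ (N + 1) ≤ (1 + r ^ 2) ^ (2 * (N + 1)) + t ^ (2 * (N + 1)) := by
        rw [e, mul_pow, mul_comm 2, pow_mul, pow_mul]
        nlinarith [sq_nonneg ((1 + r ^ 2) ^ (N + 1) - t ^ (N + 1)),
          sq_nonneg ((1 + r ^ 2) ^ (N + 1)), sq_nonneg (t ^ (N + 1))]
      have h2 : (1 + r ^ 2) ^ (2 * (N + 1)) ≤ 4 ^ (N + 1) * (1 + r ^ (4 * (N + 1))) := by
        have e4 : (4 : ℝ) ^ (N + 1) = 2 ^ (2 * (N + 1)) := by rw [pow_mul]; norm_num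
        rcases le_total r 1 with h3 | h3
        · have : 1 + r ^ 2 ≤ 2 := by nlinarith
          calc _ ≤ (2 : ℝ) ^ (2 * (N + 1)) := by gcongr
            _ ≤ _ := by
              rw [e4]
              exact le_mul_of_one_le_right (by positivity) (by
                have : 0 ≤ r ^ (4 * (N + 1)) := by positivity
                linarith)
        · have : 1 + r ^ 2 ≤ 2 * r ^ 2 := by nlinarith
          calc _ ≤ (2 * r ^ 2) ^ (2 * (N + 1)) := by gcongr
            _ = 4 ^ (N + 1) * r ^ (4 * (N + 1)) := by
              rw [mul_pow, e4, ← pow_mul]; congr 2; ring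
            _ ≤ _ := by gcongr; linarith
      have h4 : 1 ≤ (4 : ℝ) ^ (N + 1) := one_le_pow₀ (by norm_num)
      have h5 : t ^ (2 * (N + 1)) ≤ 4 ^ (N + 1) * t ^ (2 * (N + 1)) :=
        le_mul_of_one_le_left (by positivity) h4
      have h6 : (4 : ℝ) ^ (N + 1) * 1 ≤ 4 ^ (N + 1) * X := by gcongr
      rw [hX] at h6 ⊢
      linarith
    calc ‖f z‖ ≤ C * hypB z ^ N := h z hz
      _ ≤ C * hypB z ^ (N + 1) := by gcongr; omega
      _ ≤ C * (4 ^ (N + 1) * (2 * X)) := by gcongr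
      _ < C * (4 ^ (N + 1) * (2 * X)) + X := by linarith
      _ = _ := by ring

/-! ### Substitutions preserving moderate growth -/

theorem neg_inv_im_pos {z : ℂ} (hz : 0 < z.im) : 0 < (-z⁻¹).im := by
  have h0 : z ≠ 0 := by rintro rfl; simp at hz
  have := Complex.normSq_pos.2 h0
  simp only [Complex.neg_im, Complex.inv_im, neg_div, neg_neg]
  positivity

namespace ModerateGrowth

variable {f g : ℂ → ℂ}

theorem congr (hf : ModerateGrowth f) (h : ∀ z : ℂ, 0 < z.im → g z = f z) : ModerateGrowth g := by
  obtain ⟨df, C, N, hC, hb⟩ := hf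
  exact ⟨df.congr fun z hz => h z hz, C, N, hC, fun z hz => by rw [h z hz]; exact hb z hz⟩

theorem mul (hf : ModerateGrowth f) (hg : ModerateGrowth g) :
    ModerateGrowth fun z => f z * g z := by
  obtain ⟨df, C, N, hC, hb⟩ := hf
  obtain ⟨dg, C', N', hC', hb'⟩ := hg
  refine ⟨df.mul dg, C * C', N + N', by positivity, fun z hz => ?_⟩
  have hB := one_le_hypB hz
  rw [norm_mul, pow_add]
  calc _ ≤ (C * hypB z ^ N) * (C' * hypB z ^ N') :=
        mul_le_mul (hb z hz) (hb' z hz) (norm_nonneg _) (by positivity)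
    _ = _ := by ring

theorem const (a : ℂ) : ModerateGrowth fun _ => a :=
  ⟨differentiableOn_const _, ‖a‖ + 1, 0, by positivity, fun z _ => by simp⟩

/-- Composition with a holomorphic self-map of the upper half-plane which changes `hypB` by at most a
constant factor. -/
theorem comp (hf : ModerateGrowth f) {m : ℂ → ℂ} (dm : DifferentiableOn ℂ m {z | 0 < z.im})
    (hm : ∀ z : ℂ, 0 < z.im → 0 < (m z).im) {L : ℝ}
    (hL : ∀ z : ℂ, 0 < z.im → hypB (m z) ≤ L * hypB z) : ModerateGrowth fun z => f (m z) := by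
  obtain ⟨df, C, N, hC, hb⟩ := hf
  have hLpos : 0 < L := by
    have hI : 0 < Complex.I.im := by simp
    have h1 := (one_le_hypB (hm _ hI)).trans (hL _ hI)
    exact pos_of_mul_pos_left (one_pos.trans_le h1) (zero_le_one.trans (one_le_hypB hI))
  refine ⟨df.comp dm fun z hz => hm z hz, C * L ^ N, N, by positivity, fun z hz => ?_⟩
  have hB := one_le_hypB (hm z hz)
  rw [mul_assoc, ← mul_pow]
  refine (hb _ (hm z hz)).trans ?_
  gcongr
  exact hL z hz

theorem comp_add_real (hf : ModerateGrowth f) (x : ℝ) : ModerateGrowth fun z => f (z + x) :=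
  hf.comp (by fun_prop) (fun z hz => by simpa using hz) fun _ hz => hypB_add_real_le hz x

theorem comp_real_mul (hf : ModerateGrowth f) {t : ℝ} (ht : 0 < t) :
    ModerateGrowth fun z => f (t * z) := by
  refine hf.comp (L := t + t⁻¹) (by fun_prop) (fun z hz => by simpa using mul_pos ht hz)
    fun z hz => ?_
  have e1 : ((t : ℂ) * z).im = t * z.im := by simp
  have e2 : ‖(t : ℂ) * z‖ = t * ‖z‖ := by simp [abs_of_pos ht]
  rw [hypB, hypB, e1, e2, ← mul_div_assoc, div_le_div_iff₀ (mul_pos ht hz) hz]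
  have : (t + t⁻¹) * (1 + ‖z‖ ^ 2) * (t * z.im) - (1 + (t * ‖z‖) ^ 2) * z.im =
      (t ^ 2 + ‖z‖ ^ 2) * z.im := by field_simp; ring
  have : 0 ≤ (t ^ 2 + ‖z‖ ^ 2) * z.im := by positivity
  linarith

theorem comp_neg_inv (hf : ModerateGrowth f) : ModerateGrowth fun z => f (-z⁻¹) := by
  refine hf.comp (L := 1) (fun z hz => ?_) (fun z hz => neg_inv_im_pos hz) fun z hz => ?_
  · have h0 : z ≠ 0 := by rintro rfl; simp at hz
    exact ((differentiableAt_id.inv h0).neg).differentiableWithinAt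
  · have h0 : z ≠ 0 := by rintro rfl; simp at hz
    have hn := norm_pos_iff.2 h0
    refine le_of_eq ?_
    have e : (-z⁻¹).im = z.im / ‖z‖ ^ 2 := by
      rw [Complex.neg_im, Complex.inv_im, Complex.sq_norm]; ring
    rw [hypB, hypB, e, norm_neg, norm_inv]
    field_simp
    ring

theorem cpow_real (k : ℝ) : ModerateGrowth fun z => z ^ (k : ℂ) := by
  refine ⟨fun z hz => ?_, 1, ⌈|k|⌉₊, one_pos, fun z hz => ?_⟩
  · exact (differentiableAt_id.cpow_const (Or.inr (ne_of_gt hz))).differentiableWithinAt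
  · have h0 : z ≠ 0 := by rintro rfl; simp at hz
    have hn := norm_pos_iff.2 h0
    have hB := one_le_hypB hz
    have hinv : ‖z‖⁻¹ ≤ hypB z := (inv_anti₀ hz (im_le_norm z)).trans (inv_im_le_hypB hz)
    rw [Complex.norm_cpow_real, one_mul, ← Real.rpow_natCast]
    refine le_trans ?_ (Real.rpow_le_rpow_of_exponent_le hB (Nat.le_ceil |k|))
    rcases le_total 0 k with hk | hk
    · rw [abs_of_nonneg hk]
      exact Real.rpow_le_rpow hn.le (norm_le_hypB hz) hk
    · rw [abs_of_nonpos hk, ← neg_neg k, Real.rpow_neg hn.le, ← Real.inv_rpow hn.le, neg_neg]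
      exact Real.rpow_le_rpow (by positivity) hinv (by linarith)

end ModerateGrowth

/-! ### Reduction of parabolic elements to translations -/

theorem exists_moderate_solution_real_shift {G : ℂ → ℂ} (hG : ModerateGrowth G) {η : ℂ}
    (hη : ‖η‖ = 1) {h : ℝ} (hh : h ≠ 0) :
    ∃ f : ℂ → ℂ, ModerateGrowth f ∧ ∀ z : ℂ, 0 < z.im → η * f (z + h) - f z = G z := by
  have pos : ∀ {G : ℂ → ℂ}, ModerateGrowth G → ∀ {η : ℂ}, ‖η‖ = 1 → ∀ {h : ℝ}, 0 < h →
      ∃ f : ℂ → ℂ, ModerateGrowth f ∧ ∀ z : ℂ, 0 < z.im → η * f (z + h) - f z = G z := by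
    intro G hG η hη h hh
    have η0 : η ≠ 0 := by rintro rfl; simp at hη
    obtain ⟨f, hf, e⟩ := exists_moderate_solution
      ((ModerateGrowth.const η⁻¹).mul (hG.comp_real_mul hh)) (ε := η⁻¹) (by rw [norm_inv, hη, inv_one])
    refine ⟨fun z => f ((h⁻¹ : ℝ) * z), hf.comp_real_mul (inv_pos.2 hh), fun z hz => ?_⟩
    have hz' : 0 < (((h⁻¹ : ℝ) : ℂ) * z).im := by simpa using mul_pos (inv_pos.2 hh) hz
    have h1 := e _ hz'
    have hc : (h : ℂ) ≠ 0 := Complex.ofReal_ne_zero.2 hh.ne'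
    have e1 : ((h⁻¹ : ℝ) : ℂ) * (z + h) = ((h⁻¹ : ℝ) : ℂ) * z + 1 := by
      push_cast; field_simp
    have e2 : (h : ℂ) * (((h⁻¹ : ℝ) : ℂ) * z) = z := by
      push_cast; field_simp
    rw [e2] at h1
    simp only [e1]
    linear_combination η * h1 + (f (((h⁻¹ : ℝ) : ℂ) * z) + G z) * mul_inv_cancel₀ η0
  rcases hh.lt_or_gt with hneg | hpos
  · have η0 : η ≠ 0 := by rintro rfl; simp at hη
    obtain ⟨f, hf, e⟩ := pos ((ModerateGrowth.const (-η⁻¹)).mul (hG.comp_add_real (-h)))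
      (η := η⁻¹) (by rw [norm_inv, hη, inv_one]) (h := -h) (by linarith)
    refine ⟨f, hf, fun z hz => ?_⟩
    have h1 := e (z + h) (by simpa using hz)
    have e1 : z + (h : ℂ) + ((-h : ℝ) : ℂ) = z := by push_cast; ring
    rw [e1] at h1
    linear_combination (-η) * h1 + (f z + G z) * mul_inv_cancel₀ η0
  · exact pos hG hη hpos

theorem norm_rpowL (w : ℂ) (k : ℝ) : ‖rpowL w k‖ = ‖w‖ ^ k := by
  rw [rpowL, norm_mul, Complex.norm_real, mul_comm Complex.I, Complex.norm_exp_ofReal_mul_I, mul_one,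
    Real.norm_of_nonneg (by positivity)]

/-- The two normalisations of the argument differ only on the negative real axis. -/
theorem rpowL_eq_cpow {w : ℂ} (hw : w.im ≠ 0) (k : ℝ) : rpowL w k = w ^ (k : ℂ) := by
  have h0 : w ≠ 0 := by rintro rfl; simp at hw
  have harg : Complex.arg w ≠ Real.pi := fun h => hw (Complex.arg_eq_pi_iff.1 h).2
  rw [rpowL, argL, if_neg harg, Complex.cpow_def_of_ne_zero h0, Complex.log,
    Real.rpow_def_of_pos (norm_pos_iff.2 h0), Complex.ofReal_exp, ← Complex.exp_add]
  congr 1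
  push_cast
  ring

theorem differentiableOn_rpowL {c d : ℝ} (hc : c ≠ 0) (k : ℝ) :
    DifferentiableOn ℂ (fun z : ℂ => rpowL (c * z + d) k) {z | 0 < z.im} := by
  have him : ∀ z : ℂ, 0 < z.im → ((c : ℂ) * z + d).im ≠ 0 := fun z hz => by
    simpa using ⟨hc, hz.ne'⟩
  have : DifferentiableOn ℂ (fun z : ℂ => ((c : ℂ) * z + d) ^ (k : ℂ)) {z | 0 < z.im} := fun z hz => by
    have h1 : DifferentiableAt ℂ (fun z : ℂ => (c : ℂ) * z + d) z := by fun_prop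
    exact (h1.cpow_const (Or.inr (him z hz))).differentiableWithinAt
  exact this.congr fun z hz => rpowL_eq_cpow (him z hz) k

theorem eq_of_norm_eq_one {f : ℂ → ℂ} (df : DifferentiableOn ℂ f {z | 0 < z.im})
    (h : ∀ z : ℂ, 0 < z.im → ‖f z‖ = 1) {z : ℂ} (hz : 0 < z.im) : f z = f Complex.I := by
  have hI : 0 < Complex.I.im := by simp
  have hconv : Convex ℝ {z : ℂ | 0 < z.im} := convex_halfSpace_im_gt 0
  exact Complex.eqOn_of_isPreconnected_of_isMaxOn_norm hconv.isPreconnected isOpen_im_pos df hI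
    (fun w hw => by simp [h w hw, h _ hI]) hz

/-- For a parabolic real matrix with lower row `(c, d)`, the equation `ρ ∣ Q - ρ = G` is solvable
within the holomorphic functions of moderate growth. -/
theorem exists_moderate_solution_parabolic {a b c d : ℝ} (hdet : a * d - b * c = 1)
    (htr : (a + d) ^ 2 = 4) (hbc : c = 0 → b ≠ 0) {ν : ℂ} (hν : ‖ν‖ = 1) (k : ℝ) {G : ℂ → ℂ}
    (hG : ModerateGrowth G) :
    ∃ ρ : ℂ → ℂ, ModerateGrowth ρ ∧ ∀ z : ℂ, 0 < z.im →
      ρ ((a * z + b) / (c * z + d)) * ν * rpowL (c * z + d) k - ρ z = G z := by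
  by_cases hc : c = 0
  · subst hc
    have had : a = d := by nlinarith [sq_nonneg (a - d)]
    subst had
    have ha : a ^ 2 = 1 := by linarith
    have ha0 : a ≠ 0 := by rintro rfl; norm_num at ha
    have habs : |a| = 1 :=
      (pow_eq_one_iff_of_nonneg (abs_nonneg a) two_ne_zero).1 (by rw [sq_abs, ha])
    obtain ⟨f, hf, e⟩ := exists_moderate_solution_real_shift hG (η := ν * rpowL a k)
      (by rw [norm_mul, norm_rpowL, hν, Complex.norm_real, Real.norm_eq_abs, habs]; simp)
      (div_ne_zero (hbc rfl) ha0)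
    refine ⟨f, hf, fun z hz => ?_⟩
    have hac : (a : ℂ) ≠ 0 := Complex.ofReal_ne_zero.2 ha0
    have e1 : ((a : ℂ) * z + b) / (((0 : ℝ) : ℂ) * z + a) = z + ((b / a : ℝ) : ℂ) := by
      push_cast; rw [zero_mul, zero_add]; field_simp
    rw [e1, ← e z hz]
    simp only [Complex.ofReal_zero, zero_mul, zero_add]
    ring
  -- Here `x` is the fixed point and `s = ±1` the double eigenvalue; in the coordinate `z` with `w =
  -- x - 1/z` the map is `z ↦ z + h`.
  · set x := (a - d) / (2 * c) with hx
    set s := (a + d) / 2 with hs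
    set h := -(c * s) with hh
    have hs2 : s ^ 2 = 1 := by rw [hs]; linarith
    have hs0 : s ≠ 0 := by rintro h0; rw [h0] at hs2; norm_num at hs2
    have hsabs : |s| = 1 :=
      (pow_eq_one_iff_of_nonneg (abs_nonneg s) two_ne_zero).1 (by rw [sq_abs, hs2])
    have r1 : c * x + d = s := by rw [hx, hs]; field_simp; ring
    have r2 : a * x + b = s * x := by
      have : c * (a * x + b - s * x) = 0 := by
        rw [hx, hs]; field_simp; linarith
      rcases mul_eq_zero.1 this with h' | h'
      · exact absurd h' hc
      · linarith
    have r3 : s * h = -c := by rw [hh]; linear_combination (-c) * hs2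
    have r4 : s * x * h - s = -a := by
      have : c * x = a - s := by rw [hx, hs]; field_simp; ring
      linear_combination x * r3 - this
    have hh0 : h ≠ 0 := neg_ne_zero.2 (mul_ne_zero hc hs0)
    have zne : ∀ {z : ℂ}, 0 < z.im → z ≠ 0 := fun {z} hz => by rintro rfl; simp at hz
    have shift : ∀ {z : ℂ}, 0 < z.im → ∀ t : ℝ, 0 < (z + (t : ℂ)).im := fun {z} hz t => by
      simpa using hz
    have inv' : ∀ {z : ℂ}, 0 < z.im → 0 < (-z⁻¹ + x).im := fun {z} hz =>
      shift (neg_inv_im_pos hz) x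
    have fac : ∀ {z : ℂ}, 0 < z.im → (c : ℂ) * (-z⁻¹ + x) + d = s * (z + h) / z := fun {z} hz => by
      have := zne hz
      have r1' : (c : ℂ) * x + d = s := by exact_mod_cast r1
      have r3' : (s : ℂ) * h = -c := by exact_mod_cast r3
      field_simp
      linear_combination z * r1' - r3'
    have num : ∀ {z : ℂ}, 0 < z.im →
        (a : ℂ) * (-z⁻¹ + x) + b = (-(z + h)⁻¹ + x) * (s * (z + h) / z) := fun {z} hz => by
      have := zne hz
      have h2 := zne (shift hz h)
      have r2' : (a : ℂ) * x + b = s * x := by exact_mod_cast r2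
      have r4' : (s : ℂ) * x * h - s = -a := by exact_mod_cast r4
      field_simp
      linear_combination z * r2' - r4'
    -- The automorphy factor after conjugation by `z^k`. It is holomorphic of modulus `1`, hence
    -- constant, so no branches of the powers need to be compared.
    set E : ℂ → ℂ := fun z => z ^ (k : ℂ) * (z + h) ^ ((-k : ℝ) : ℂ) * ν *
      rpowL (c * (-z⁻¹ + x) + d) k with hE
    have dE : DifferentiableOn ℂ E {z | 0 < z.im} := by
      have d1 := (ModerateGrowth.cpow_real k).1
      have d2 := ((ModerateGrowth.cpow_real (-k)).comp_add_real h).1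
      have dm : DifferentiableOn ℂ (fun z : ℂ => -z⁻¹ + x) {z | 0 < z.im} := fun z hz =>
        ((differentiableAt_id.inv (zne (z := z) hz)).neg.add_const _).differentiableWithinAt
      have d3 := (differentiableOn_rpowL (d := d) hc k).comp dm fun z hz => inv' hz
      exact ((d1.mul d2).mul_const ν).mul d3
    have nE : ∀ z : ℂ, 0 < z.im → ‖E z‖ = 1 := fun z hz => by
      have n1 := norm_pos_iff.2 (zne hz)
      have n2 := norm_pos_iff.2 (zne (shift hz h))
      simp only [hE, norm_mul, Complex.norm_cpow_real, hν, norm_rpowL, fac hz, norm_div,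
        Complex.norm_real, Real.norm_eq_abs, hsabs, one_mul, mul_one]
      rw [Real.div_rpow n2.le n1.le, Real.rpow_neg n2.le]
      have := Real.rpow_pos_of_pos n1 k
      have := Real.rpow_pos_of_pos n2 k
      field_simp
    have hI : 0 < Complex.I.im := by simp
    obtain ⟨R, hR, e⟩ := exists_moderate_solution_real_shift
      (((hG.comp_add_real x).comp_neg_inv).mul (ModerateGrowth.cpow_real k)) (nE _ hI) hh0
    -- Undoing the substitution: `z = -1/(w - x)` and `ρ(w) = z^(-k) R(z)`.
    refine ⟨fun w => R (-(w + ((-x : ℝ) : ℂ))⁻¹) * (-(w + ((-x : ℝ) : ℂ))⁻¹) ^ ((-k : ℝ) : ℂ),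
      ((hR.mul (ModerateGrowth.cpow_real (-k))).comp_neg_inv).comp_add_real (-x), fun w hw => ?_⟩
    obtain ⟨z, hz, rfl⟩ : ∃ z : ℂ, 0 < z.im ∧ -z⁻¹ + x = w := by
      refine ⟨-(w + ((-x : ℝ) : ℂ))⁻¹, neg_inv_im_pos (shift hw _), ?_⟩
      rw [inv_neg, inv_inv]; push_cast; ring
    have z0 := zne hz
    have zh0 := zne (shift hz h)
    have hsc : (s : ℂ) ≠ 0 := Complex.ofReal_ne_zero.2 hs0
    have q1 : ((a : ℂ) * (-z⁻¹ + x) + b) / (c * (-z⁻¹ + x) + d) = -(z + h)⁻¹ + x := by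
      rw [num hz, fac hz, mul_div_cancel_right₀]
      exact div_ne_zero (mul_ne_zero hsc zh0) z0
    have back : ∀ u : ℂ, -(-u⁻¹ + (x : ℂ) + ((-x : ℝ) : ℂ))⁻¹ = u := fun u => by
      rw [show -u⁻¹ + (x : ℂ) + ((-x : ℝ) : ℂ) = -u⁻¹ by push_cast; ring, inv_neg, inv_inv, neg_neg]
    have e1 := e z hz
    rw [← eq_of_norm_eq_one dE nE hz] at e1
    have hk0 : z ^ (k : ℂ) ≠ 0 := by simp [Complex.cpow_eq_zero_iff, z0]
    have hkk : z ^ (k : ℂ) * z ^ ((-k : ℝ) : ℂ) = 1 := by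
      rw [Complex.ofReal_neg, Complex.cpow_neg, mul_inv_cancel₀ hk0]
    simp only [q1, back]
    refine mul_left_cancel₀ hk0 ?_
    simp only [hE] at e1
    linear_combination e1 - R z * hkk

theorem parabolic_entries {Q : SL(2, ℤ)} (hQ : IsParabolicElt Q) :
    ((Q 0 0 : ℝ) + Q 1 1) ^ 2 = 4 ∧ ((Q 1 0 : ℝ) = 0 → (Q 0 1 : ℝ) ≠ 0) := by
  obtain ⟨h1, h2⟩ := hQ
  have hdet : (Q 0 0 : ℝ) * Q 1 1 - Q 0 1 * Q 1 0 = 1 := by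
    have := Q.det_coe
    rw [Matrix.det_fin_two] at this
    exact_mod_cast this
  rw [Matrix.discr_fin_two, Matrix.trace_fin_two, Matrix.det_fin_two] at h2
  simp only [Matrix.SpecialLinearGroup.mapGL_coe_matrix, Matrix.SpecialLinearGroup.map_apply_coe,
    RingHom.mapMatrix_apply, Matrix.map_apply, algebraMap_int_eq, Int.coe_castRingHom] at h2
  have htr : ((Q 0 0 : ℝ) + Q 1 1) ^ 2 = 4 := by linear_combination h2 + 4 * hdet
  refine ⟨htr, fun hc hb => h1 ⟨(Q 0 0 : ℝ), ?_⟩⟩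
  have had : (Q 0 0 : ℝ) = Q 1 1 := by
    rw [hc, hb] at hdet
    nlinarith [sq_nonneg ((Q 0 0 : ℝ) - Q 1 1)]
  rw [Matrix.scalar_apply]
  ext i j
  fin_cases i <;> fin_cases j <;> simp [hc, hb, had]

/-- The condition `‖v Q‖ = 1` makes the constant `(v Q)⁻¹` unimodular, as the difference equation
requires. -/
theorem exists_primitive_of_parabolic {Γ : Subgroup SL(2, ℤ)} {k : ℝ} {v : Γ → ℂ} {Q : Γ}
    (hQ : IsParabolicElt (Q : SL(2, ℤ))) (hv : ‖v Q‖ = 1) {g : ℍ → ℂ} (hg : g ∈ spaceP) :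
    ∃ ρ ∈ spaceP, g = stroke (-k) v ρ Q - ρ := by
  obtain ⟨htr, hbc⟩ := parabolic_entries hQ
  have hdet : ((Q : SL(2, ℤ)) 0 0 : ℝ) * (Q : SL(2, ℤ)) 1 1 -
      (Q : SL(2, ℤ)) 0 1 * (Q : SL(2, ℤ)) 1 0 = 1 := by
    have := (Q : SL(2, ℤ)).det_coe
    rw [Matrix.det_fin_two] at this
    exact_mod_cast this
  obtain ⟨ρ, hρ, e⟩ := exists_moderate_solution_parabolic hdet htr hbc (ν := (v Q)⁻¹)
    (by rw [norm_inv, hv, inv_one]) k (moderateGrowth_of_spaceP hg)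
  refine ⟨_, spaceP_of_moderateGrowth hρ, ?_⟩
  ext z
  have h := e z z.im_pos
  rw [Function.comp_apply, ofComplex_apply] at h
  rw [← h, Pi.sub_apply, stroke, coe_specialLinearGroup_apply, autFactor, neg_neg]
  simp

end EichlerCohomology

end

theorem theorem1 (Γ : Subgroup SL(2, ℤ)) [Γ.FiniteIndex] (k : ℝ) (v : Γ → ℂ)
    (hv : EichlerCohomology.IsMultiplierSystem Γ (-k) v)
    (hp : EichlerCohomology.IsWeaklyParabolic Γ v) :
    (∀ φ ∈ EichlerCohomology.cocycles Γ (-k) v,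
      φ ∈ EichlerCohomology.parabolicCocycles Γ (-k) v) ∧
    EichlerCohomology.parabolicCohomology Γ (-k) v = ⊤ := by
  have main : ∀ φ ∈ EichlerCohomology.cocycles Γ (-k) v,
      φ ∈ EichlerCohomology.parabolicCocycles Γ (-k) v := fun φ hφ =>
    ⟨hφ, fun q Q hQ => EichlerCohomology.exists_primitive_of_parabolic hQ.parabolic
      (hp Q hQ.parabolic) (hφ.1 Q)⟩
  refine ⟨main, ?_⟩
  rw [EichlerCohomology.parabolicCohomology,
    Submodule.submoduleOf_eq_top.2 (fun φ hφ => main φ hφ), Submodule.map_top, Submodule.range_mkQ]
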